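/- Let $L$ be the one-sided infinite ladder: its vertices are $a_n, b_n$ ($n \ge 1$), and its edges are the upper edges $u_n = a_na_{n+1}$, the lower edges $d_n = b_nb_{n+1}$ and the rungs $r_n = a_nb_n$ ($n \ge 1$). Let $H$ be the multigraph obtained from $L$ by doubling every edge, that is, by adding to every edge $e$ a parallel clone $e'$. Let $M = M_A(H)$ be the algebraic cycle matroid of $H$: the matroid on $E(H)$ whose circuits are the edge sets of finite cycles of $H$ (including pairs of parallel edges) and the edge sets of double rays (two-sided infinite paths) of $H$. Let $M \vee M$ be the union of $M$ with itself: the pair of the ground set $E(H)$ and the family $\{I_1 \cup I_2 \mid I_1, I_2 \text{ independent in } M\}$. A matroid is called wild if it has a circuit and a cocircuit whose intersection is infinite. Theorem 4.3. The algebraic cycle matroid $M = M_A(H)$ exists, $M \vee M$ is (the ground set and the family of independent sets of) a matroid, and this matroid is wild. More precisely, the set $C$ that consists of all horizontal edges $u_n, u_n', d_n, d_n'$ ($n \ge 1$) and the rung $r_1$ is a circuit of $M \vee M$, and $M \vee M$ has a cocircuit $D$ such that $C \cap D$ is infinite. -/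

import Mathlib

namespace Graph

variable {α β : Type*}

/-- `C` is the edge set of a finite cycle of the multigraph `G`: there are `n ≥ 1` distinct vertices
and `n` distinct edges, indexed cyclically, such that the `i`-th edge joins the `i`-th vertex to the
`(i + 1)`-st one. (Loops are the cycles of length 1, pairs of parallel edges those of length 2.) -/
def IsFiniteCycleSet (G : Graph α β) (C : Set β) : Prop :=
  ∃ n : ℕ, n ≠ 0 ∧ ∃ (v : ZMod n → α) (e : ZMod n → β),
    Function.Injective v ∧ Function.Injective e ∧
      (∀ i, G.IsLink (e i) (v i) (v (i + 1))) ∧ C = Set.range e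

/-- `C` is the edge set of a double ray (a two-sided infinite path) of the multigraph `G`. -/
def IsDoubleRaySet (G : Graph α β) (C : Set β) : Prop :=
  ∃ (v : ℤ → α) (e : ℤ → β), Function.Injective v ∧
    (∀ i, G.IsLink (e i) (v i) (v (i + 1))) ∧ C = Set.range e

/-- The multigraph obtained from `G` by doubling every edge `e`: the original edge is `(e, false)`,
its clone is `(e, true)`. -/
def double (G : Graph α β) : Graph α (β × Bool) where
  vertexSet := G.vertexSet
  IsLink e x y := G.IsLink e.1 x y
  edgeSet := {e | e.1 ∈ G.edgeSet}
  isLink_symm _ he := G.isLink_symm he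
  eq_or_eq_of_isLink_of_isLink _ _ _ _ _ h h' := G.eq_or_eq_of_isLink_of_isLink h h'
  edge_mem_iff_exists_isLink e := G.edge_mem_iff_exists_isLink e.1
  left_mem_of_isLink _ _ _ h := G.left_mem_of_isLink h

end Graph

namespace Matroid

variable {α β : Type*}

/-- `M` is the algebraic cycle matroid `M_A(G)` of the graph `G`: its ground set is the edge set of
`G`, and its circuits are the edge sets of finite cycles and of double rays of `G`. (A matroid is
determined by its ground set and its circuits, so there is at most one such `M`.) -/
structure IsAlgebraicCycleMatroid (M : Matroid β) (G : Graph α β) : Prop where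
  ground_eq : M.E = G.edgeSet
  isCircuit_iff : ∀ C : Set β, M.IsCircuit C ↔ G.IsFiniteCycleSet C ∨ G.IsDoubleRaySet C

/-- `N` is the union `M₁ ∨ M₂`: its ground set is the union of the ground sets, and its independent
sets are the unions of an independent set of `M₁` and an independent set of `M₂`. (So there is at
most one such `N`, and there is one if and only if the union of `M₁` and `M₂` is a matroid.) -/
structure IsUnionOf (N M₁ M₂ : Matroid β) : Prop where
  ground_eq : N.E = M₁.E ∪ M₂.E
  indep_iff : ∀ I : Set β, N.Indep I ↔ ∃ I₁ I₂ : Set β, M₁.Indep I₁ ∧ M₂.Indep I₂ ∧ I = I₁ ∪ I₂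

/-- A matroid is tame if every circuit meets every cocircuit in a finite set. -/
def IsTame (M : Matroid β) : Prop :=
  ∀ C D : Set β, M.IsCircuit C → M.IsCocircuit D → (C ∩ D).Finite

/-- A matroid is wild if it is not tame. -/
def IsWild (M : Matroid β) : Prop := ¬ M.IsTame

end Matroid

/-- The edges of the one-sided infinite ladder: upper edges `u n`, lower edges `d n` and rungs `r n`.
Indices start at `0`, so `u n`, `d n`, `r n` are `u_{n+1}`, `d_{n+1}`, `r_{n+1}` when one counts
from `1`. -/
inductive LadderEdge : Type
  | u (n : ℕ)
  | d (n : ℕ)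
  | r (n : ℕ)

/-- The ends of an edge of the ladder; `(n, true)` is the `n`-th upper vertex and `(n, false)` the
`n`-th lower vertex. -/
def LadderEdge.ends : LadderEdge → Sym2 (ℕ × Bool)
  | .u n => s((n, true), (n + 1, true))
  | .d n => s((n, false), (n + 1, false))
  | .r n => s((n, true), (n, false))

/-- The one-sided infinite ladder `L`. -/
def ladder : Graph (ℕ × Bool) LadderEdge where
  vertexSet := Set.univ
  IsLink e x y := s(x, y) = e.ends
  edgeSet := Set.univ
  isLink_symm _ _ := ⟨fun _ _ h => Sym2.eq_swap.trans h⟩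
  eq_or_eq_of_isLink_of_isLink _ _ _ _ _ h h' := by
    rcases Sym2.eq_iff.1 (h.trans h'.symm) with h | h
    · exact Or.inl h.1
    · exact Or.inr h.1
  edge_mem_iff_exists_isLink e := by
    refine ⟨fun _ => ?_, fun _ => Set.mem_univ e⟩
    cases e <;> exact ⟨_, _, rfl⟩
  left_mem_of_isLink _ _ _ _ := Set.mem_univ _

/-- The graph `H`: the one-sided infinite ladder with every edge doubled. -/
def doubledLadder : Graph (ℕ × Bool) (LadderEdge × Bool) := ladder.double

/-- All horizontal edges of `H` (the upper and the lower edges and their clones), together with the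
first rung (but not its clone). -/
def ladderCircuit : Set (LadderEdge × Bool) :=
  {e | (∃ n, e.1 = LadderEdge.u n) ∨ (∃ n, e.1 = LadderEdge.d n) ∨ e = (LadderEdge.r 0, false)}

/-! Existence of M. Sending each edge of the ladder to the difference of the bounded faces on its
two sides represents the finite cycle matroid of the planar dual. In the dual of that matroid, a set
is independent iff it contains no finite cycle and no double ray (`ladderMatroid_indep_iff`).
Pulling back along the projection that forgets the copy makes clones parallel.

Existence of the union. Call a set a forest if it has no finite cycle; double rays are allowed. By
compactness the unions of two forests form a finitary matroid F (`biForestMatroid`), with which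
unions of two rayless forests are compared. If J misses infinitely many copies of rails, two forests
covering J can be recombined so that all double rays vanish (`BiForest.biRaylessForest`). If J
contains all copies of the rails from column n on, then J is a union of two rayless forests iff, for
a rung beyond column n, J avoids both of its copies and remains independent in F when they are added
(`BiRaylessForest.biForest_union_rungPair`, `BiForest.biRaylessForest_of_union_rungPair`). So the
axioms are inherited from F. Where the two cases meet, `not_biForest_insert_rung` serves exchange
and `BiForest.exists_finite_biRaylessForest_sdiff` serves the existence of maximal sets.

Wildness. Covering C forces all rails into both forests, so whichever receives `r 0` has a double
ray; removing any edge of C cures this. The cocircuit consists of the clones of lower rails and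
rungs: its complement plus any one of its edges is a base, since two forests have at most 4m + 2
edges between columns 0 and m (`Forest.sum_columns_le`). It shares with C the clones of all lower
rails. -/

/-! ### Matroids of vector families and their duals. -/

section VectorMatroid

open Set Submodule

variable {K W α : Type*} [Field K] [AddCommGroup W] [Module K W]

/-- The matroid of linear independence of a family of vectors. -/
noncomputable def vectorMatroid (K : Type*) {W α : Type*} [Field K] [AddCommGroup W] [Module K W]
    (v : α → W) : Matroid α :=
  (IndepMatroid.ofFinitaryCardAugment univ (fun I => LinearIndepOn K v I)
    (linearIndepOn_empty K v) (fun _ _ h hs => h.mono hs)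
    (by
      intro I J hI hIf hJ hJf hlt
      by_contra! hcon
      have hsub : v '' J ⊆ span K (v '' I) := by
        rintro _ ⟨e, he, rfl⟩
        by_contra hne
        by_cases heI : e ∈ I
        · exact hne (subset_span (mem_image_of_mem v heI))
        · exact hcon e he heI (hI.insert hne)
      have hfin : Finite J := hJf
      have hfinI : Finite I := hIf
      have := hJf.fintype
      have := hIf.fintype
      have h1 : Module.finrank K (span K (v '' J)) = J.ncard := by
        rw [image_eq_range, finrank_span_eq_card hJ, ← Nat.card_eq_fintype_card]
        rfl
      have h2 : Module.finrank K (span K (v '' I)) = I.ncard := by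
        rw [image_eq_range, finrank_span_eq_card hI, ← Nat.card_eq_fintype_card]
        rfl
      have : FiniteDimensional K (span K (v '' I)) :=
        FiniteDimensional.span_of_finite K (hIf.image v)
      have h3 : span K (v '' J) ≤ span K (v '' I) := span_le.2 hsub
      have := Submodule.finrank_mono h3
      omega)
    (fun I h => linearIndepOn_of_finite I fun t ht hf => h t ht hf)
    (fun _ _ => subset_univ _)).matroid

@[simp] lemma vectorMatroid_ground (v : α → W) : (vectorMatroid K v).E = univ := rfl

lemma vectorMatroid_coindep_iff (v : α → W) (A : Set α) :
    (vectorMatroid K v)✶.Indep A ↔ ∀ e, v e ∈ span K (v '' Aᶜ) := by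
  rw [Matroid.dual_indep_iff_exists (by simp)]
  constructor
  · rintro ⟨B, hB, hd⟩ e
    by_contra hne
    have hBA : B ⊆ Aᶜ := hd.subset_compl_left
    have hne' : v e ∉ span K (v '' B) := fun h => hne (span_mono (image_mono hBA) h)
    have heB : e ∉ B := fun h => hne' (subset_span (mem_image_of_mem v h))
    have hB' : LinearIndepOn K v B := hB.indep
    exact heB (hB.mem_of_insert_indep (e := e) (hB'.insert hne'))
  · intro h
    obtain ⟨B, hB⟩ := (vectorMatroid K v).exists_isBasis Aᶜ
    have hBi : LinearIndepOn K v B := hB.indep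
    have key : ∀ e ∈ Aᶜ, v e ∈ span K (v '' B) := by
      intro e he
      by_contra hne
      have heB : e ∉ B := fun h => hne (subset_span (mem_image_of_mem v h))
      exact heB (hB.mem_of_insert_indep he (hBi.insert hne))
    have hle : span K (v '' Aᶜ) ≤ span K (v '' B) :=
      span_le.2 (by rintro _ ⟨e, he, rfl⟩; exact key e he)
    refine ⟨B, ?_, disjoint_compl_right.mono_right hB.subset⟩
    refine hB.indep.isBase_of_forall_insert fun e he hi => ?_
    have hi' : LinearIndepOn K v (insert e B) := hi
    exact (linearIndepOn_insert he.2).1 hi' |>.2 (hle (h e))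

end VectorMatroid

/-! ### The algebraic cycle matroid of the ladder, by planar duality. -/

namespace LadderEdge

open Set

/-- Both rails between columns `k` and `k + 1` belong to `A`. -/
def Rails (A : Set LadderEdge) (k : ℕ) : Prop := u k ∈ A ∧ d k ∈ A

/-- `A` contains no finite cycle of the ladder. -/
def Forest (A : Set LadderEdge) : Prop :=
  ∀ i j, i < j → r i ∈ A → r j ∈ A → ¬ ∀ k, i ≤ k → k < j → Rails A k

/-- `A` contains neither a finite cycle nor a double ray of the ladder. -/
def RaylessForest (A : Set LadderEdge) : Prop :=
  Forest A ∧ ∀ i, r i ∈ A → ¬ ∀ k, i ≤ k → Rails A k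

/-- The incidence vectors of the edges with the bounded faces of the ladder. -/
noncomputable def faceVector : LadderEdge → (ℕ →₀ ℚ)
  | u k => Finsupp.single k 1
  | d k => Finsupp.single k 1
  | r 0 => Finsupp.single 0 1
  | r (k + 1) => Finsupp.single (k + 1) 1 - Finsupp.single k 1

/-- The algebraic cycle matroid of the ladder, as the dual of the matroid of its face vectors. -/
noncomputable def ladderMatroid : Matroid LadderEdge := (vectorMatroid ℚ faceVector)✶

-- `S` is a set of bounded faces whose boundary lies in `A`. The functional summing the coordinates
-- in `S` kills every edge outside `A`, because such an edge has both or neither of its sides in `S`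
-- (the outer face counting as not in `S`); it takes the value 1 on a face of `S`.
open Classical in
lemma exists_faceVector_notMem_span {A : Set LadderEdge} {S : Set ℕ} {i : ℕ} (hi : i ∈ S)
    (hrails : ∀ k ∈ S, Rails A k) (hzero : 0 ∈ S → r 0 ∈ A)
    (hrung : ∀ k, ¬ (k ∈ S ↔ k + 1 ∈ S) → r (k + 1) ∈ A) :
    faceVector (u i) ∉ Submodule.span ℚ (faceVector '' Aᶜ) := by
  intro hmem
  let φ : (ℕ →₀ ℚ) →ₗ[ℚ] ℚ := Finsupp.linearCombination ℚ (fun k => if k ∈ S then (1 : ℚ) else 0)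
  have hle : Submodule.span ℚ (faceVector '' Aᶜ) ≤ LinearMap.ker φ := by
    rw [Submodule.span_le]
    rintro _ ⟨e, he, rfl⟩
    simp only [SetLike.mem_coe, LinearMap.mem_ker]
    match e, he with
    | u k, he =>
      have : k ∉ S := fun h => he (hrails k h).1
      simp [φ, faceVector, this]
    | d k, he =>
      have : k ∉ S := fun h => he (hrails k h).2
      simp [φ, faceVector, this]
    | r 0, he =>
      have : 0 ∉ S := fun h => he (hzero h)
      simp [φ, faceVector, this]
    | r (k + 1), he =>
      have : (k ∈ S ↔ k + 1 ∈ S) := by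
        by_contra h
        exact he (hrung k h)
      simp [φ, faceVector, this]
  have := hle hmem
  simp [φ, faceVector, hi] at this

/-- For one direction, `S` is the set of faces on one side of a cycle or double ray. Conversely, a
face outside the span has both its rails in `A`, and a rung outside `A` passes this property on to
the neighbouring face. A maximal run of such faces ends on the left at a rung of `A` and on the
right at another rung or not at all, so it is bounded by a cycle or a double ray. -/
lemma ladderMatroid_indep_iff (A : Set LadderEdge) : ladderMatroid.Indep A ↔ RaylessForest A := by
  rw [ladderMatroid, vectorMatroid_coindep_iff]
  constructor
  · refine fun h => ⟨fun i j hij hi hj hk => ?_, fun i hi hk => ?_⟩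
    · refine exists_faceVector_notMem_span (A := A) (S := {k | i ≤ k ∧ k < j}) (i := i)
        ⟨le_rfl, hij⟩ (fun k hk' => hk k hk'.1 hk'.2) (fun h0 => ?_) (fun k hk' => ?_) (h _)
      · obtain rfl : i = 0 := by simpa using h0.1
        exact hi
      · simp only [mem_ofPred_eq] at hk'
        by_cases h1 : k + 1 = i
        · rwa [h1]
        · by_cases h2 : k + 1 = j
          · rwa [h2]
          · omega
    · refine exists_faceVector_notMem_span (A := A) (S := {k | i ≤ k}) (i := i)
        (le_refl i) (fun k hk' => hk k hk') (fun h0 => ?_) (fun k hk' => ?_) (h _)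
      · obtain rfl : i = 0 := by simpa using h0
        exact hi
      · simp only [mem_ofPred_eq] at hk'
        by_cases h1 : k + 1 = i
        · rwa [h1]
        · omega
  · rintro ⟨hF, hR⟩
    set V := Submodule.span ℚ (faceVector '' Aᶜ) with hV
    have hmem : ∀ e, e ∉ A → faceVector e ∈ V :=
      fun e he => Submodule.subset_span (mem_image_of_mem _ he)
    have hrails : ∀ k, Finsupp.single k (1 : ℚ) ∉ V → Rails A k := by
      intro k hk
      constructor
      · by_contra h
        exact hk (hmem _ h)
      · by_contra h
        exact hk (hmem _ h)
    have hstep : ∀ k, r (k + 1) ∉ A →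
        (Finsupp.single k (1 : ℚ) ∈ V ↔ Finsupp.single (k + 1) (1 : ℚ) ∈ V) := by
      intro k hk
      have h1 : Finsupp.single (k + 1) (1 : ℚ) - Finsupp.single k 1 ∈ V := hmem _ hk
      constructor
      · intro h
        simpa using V.add_mem h1 h
      · intro h
        simpa using V.sub_mem h h1
    have hleft : ∀ k, Finsupp.single k (1 : ℚ) ∉ V →
        ∃ i ≤ k, r i ∈ A ∧ ∀ l, i ≤ l → l ≤ k → Finsupp.single l (1 : ℚ) ∉ V := by
      intro k
      induction k with
      | zero =>
        intro hk
        refine ⟨0, le_rfl, by_contra fun h => hk (hmem _ h), fun l _ hl => ?_⟩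
        obtain rfl : l = 0 := by omega
        exact hk
      | succ k ih =>
        intro hk
        by_cases hr : r (k + 1) ∈ A
        · refine ⟨k + 1, le_rfl, hr, fun l h1 h2 => ?_⟩
          obtain rfl : l = k + 1 := by omega
          exact hk
        · obtain ⟨i, hi, hri, hl⟩ := ih ((hstep k hr).not.2 hk)
          refine ⟨i, by omega, hri, fun l h1 h2 => ?_⟩
          rcases Nat.lt_or_eq_of_le h2 with h | rfl
          · exact hl l h1 (by omega)
          · exact hk
    have hq : ∀ k, Finsupp.single k (1 : ℚ) ∈ V := by
      intro k
      by_contra hk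
      obtain ⟨i, hik, hri, hl⟩ := hleft k hk
      have hright : ∀ m, (∀ j, k < j → j ≤ m → r j ∉ A) → ∀ l, i ≤ l → l ≤ m →
          Finsupp.single l (1 : ℚ) ∉ V := by
        intro m
        induction m with
        | zero => exact fun _ l h1 h2 => hl l h1 (by omega)
        | succ m ih =>
          intro hj l h1 h2
          rcases Nat.lt_or_eq_of_le h2 with h | rfl
          · exact ih (fun j h3 h4 => hj j h3 (by omega)) l h1 (by omega)
          · by_cases hmk : m + 1 ≤ k
            · exact hl _ h1 hmk
            · exact (hstep m (hj _ (by omega) le_rfl)).not.1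
                (ih (fun j h3 h4 => hj j h3 (by omega)) m (by omega) le_rfl)
      by_cases hex : ∃ j, k < j ∧ r j ∈ A
      · classical
        obtain ⟨hkj, hrj⟩ := Nat.find_spec hex
        refine hF i _ (by omega) hri hrj fun l h1 h2 => hrails l ?_
        refine hright l (fun j h3 h4 h5 => ?_) l h1 le_rfl
        exact Nat.find_min hex (by omega) ⟨h3, h5⟩
      · push Not at hex
        exact hR i hri fun l h1 => hrails l (hright l (fun j h3 _ => hex j h3) l h1 le_rfl)
    intro e
    match e with
    | u k => exact hq k
    | d k => exact hq k
    | r 0 => exact hq 0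
    | r (k + 1) => exact V.sub_mem (hq _) (hq _)

lemma mem_ends_true_iff {x : LadderEdge} {n : ℕ} :
    (n, true) ∈ x.ends ↔ x = u n ∨ x = r n ∨ ∃ m, n = m + 1 ∧ x = u m := by
  cases x <;> simp [ends] <;> grind

lemma mem_ends_false_iff {x : LadderEdge} {n : ℕ} :
    (n, false) ∈ x.ends ↔ x = d n ∨ x = r n ∨ ∃ m, n = m + 1 ∧ x = d m := by
  cases x <;> simp [ends] <;> grind

lemma not_isDiag_ends (x : LadderEdge) : ¬ x.ends.IsDiag := by
  cases x <;> simp [ends]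

/-- A nonempty set of edges of the ladder without vertices of degree one contains a finite cycle
or a double ray. -/
lemma not_raylessForest_of_no_leaf {A : Set LadderEdge} (hne : A.Nonempty)
    (hA : ∀ x ∈ A, ∀ w ∈ x.ends, ∃ y ∈ A, y ≠ x ∧ w ∈ y.ends) : ¬ RaylessForest A := by
  classical
  rintro ⟨hF, hR⟩
  have hex : ∃ k, ∃ b, ∃ x ∈ A, (k, b) ∈ x.ends := by
    obtain ⟨x, hx⟩ := hne
    cases x with
    | u n => exact ⟨n, true, _, hx, by simp [ends]⟩
    | d n => exact ⟨n, false, _, hx, by simp [ends]⟩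
    | r n => exact ⟨n, true, _, hx, by simp [ends]⟩
  -- Column `k` is the leftmost one met by `A`, so no rail arrives there from the left and a vertex
  -- without leaf edge needs both its rung and its right rail.
  obtain ⟨k, ⟨b, x, hx, hkx⟩, hmin⟩ : ∃ k, (∃ b, ∃ x ∈ A, (k, b) ∈ x.ends) ∧
      ∀ l < k, ¬ ∃ b, ∃ x ∈ A, (l, b) ∈ x.ends :=
    ⟨Nat.find hex, Nat.find_spec hex, fun l hl => Nat.find_min hex hl⟩
  have hu : ∀ m, k = m + 1 → u m ∉ A := fun m hm h =>
    hmin m (by omega) ⟨true, _, h, by simp [ends]⟩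
  have hd : ∀ m, k = m + 1 → d m ∉ A := fun m hm h =>
    hmin m (by omega) ⟨false, _, h, by simp [ends]⟩
  have htrue : ∀ x ∈ A, (k, true) ∈ x.ends → r k ∈ A ∧ u k ∈ A := by
    intro x hx hkx
    obtain ⟨y, hy, hyx, hky⟩ := hA x hx _ hkx
    rw [mem_ends_true_iff] at hkx hky
    grind
  have hfalse : ∀ x ∈ A, (k, false) ∈ x.ends → r k ∈ A ∧ d k ∈ A := by
    intro x hx hkx
    obtain ⟨y, hy, hyx, hky⟩ := hA x hx _ hkx
    rw [mem_ends_false_iff] at hkx hky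
    grind
  have hr : r k ∈ A := by
    cases b
    · exact (hfalse x hx hkx).1
    · exact (htrue x hx hkx).1
  have hk : Rails A k :=
    ⟨(htrue _ hr (by simp [ends])).2, (hfalse _ hr (by simp [ends])).2⟩
  have hright : ∀ m, k ≤ m → (∀ j, k < j → j ≤ m → r j ∉ A) → Rails A m := by
    intro m hm
    induction m, hm using Nat.le_induction with
    | base => exact fun _ => hk
    | succ m hm ih =>
      intro hj
      obtain ⟨h1, h2⟩ := ih fun j h h' => hj j h (by omega)
      have h3 : r (m + 1) ∉ A := hj _ (by omega) le_rfl
      obtain ⟨y, hy, hyx, hky⟩ := hA _ h1 (m + 1, true) (by simp [ends])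
      obtain ⟨z, hz, hzx, hkz⟩ := hA _ h2 (m + 1, false) (by simp [ends])
      rw [mem_ends_true_iff] at hky
      rw [mem_ends_false_iff] at hkz
      constructor <;> grind
  by_cases hex : ∃ j, k < j ∧ r j ∈ A
  · obtain ⟨hkj, hrj⟩ := Nat.find_spec hex
    refine hF k _ hkj hr hrj fun l h1 h2 => hright l h1 fun j h3 h4 h5 => ?_
    exact Nat.find_min hex (by omega) ⟨h3, h5⟩
  · push Not at hex
    exact hR k hr fun l h1 => hright l h1 fun j h3 _ => hex j h3

end LadderEdge

/-! ### Cycles and double rays of the doubled ladder as circuits. -/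

section DoubledLadder

open Set LadderEdge

lemma doubledLadder_isLink_iff {e : LadderEdge × Bool} {x y : ℕ × Bool} :
    doubledLadder.IsLink e x y ↔ s(x, y) = e.1.ends := Iff.rfl

/-- `C` is the edge set of a trail of `H` indexed by the cyclic group `G` that visits no vertex
twice. -/
structure IsCyclicPath (G : Type) [CommRing G] (v : G → ℕ × Bool) (e : G → LadderEdge × Bool) :
    Prop where
  cast_surjective : Function.Surjective (Int.cast : ℤ → G)
  vertex_injective : Function.Injective v
  edge_injective : Function.Injective e
  ends_eq : ∀ i, s(v i, v (i + 1)) = (e i).1.ends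

namespace IsCyclicPath

variable {G : Type} [CommRing G] {v : G → ℕ × Bool} {e : G → LadderEdge × Bool}

lemma one_ne_zero (h : IsCyclicPath G v e) : (1 : G) ≠ 0 := by
  intro h1
  refine not_isDiag_ends (e 0).1 ?_
  rw [← h.ends_eq, h1]
  simp

lemma mem_ends_iff (h : IsCyclicPath G v e) {i j : G} :
    v i ∈ (e j).1.ends ↔ i = j ∨ i = j + 1 := by
  rw [← h.ends_eq, Sym2.mem_iff, h.vertex_injective.eq_iff, h.vertex_injective.eq_iff]

lemma no_leaf (h : IsCyclicPath G v e) {x : LadderEdge × Bool} (hx : x ∈ range e)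
    {w : ℕ × Bool} (hw : w ∈ x.1.ends) : ∃ y ∈ range e, y ≠ x ∧ w ∈ y.1.ends := by
  obtain ⟨i, rfl⟩ := hx
  have h10 := h.one_ne_zero
  have hw' := hw
  rw [← h.ends_eq, Sym2.mem_iff] at hw'
  rcases hw' with rfl | rfl
  · refine ⟨_, ⟨i - 1, rfl⟩, ?_, h.mem_ends_iff.2 (Or.inr (by ring))⟩
    rw [h.edge_injective.ne_iff]
    simpa using h10
  · refine ⟨_, ⟨i + 1, rfl⟩, ?_, h.mem_ends_iff.2 (Or.inl rfl)⟩
    rw [h.edge_injective.ne_iff]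
    simpa using h10

/-- A nonempty set of edges of a cyclic path that has no leaf is the whole path. -/
lemma eq_of_subset (h : IsCyclicPath G v e) {C : Set (LadderEdge × Bool)} (hC : C ⊆ range e)
    (hne : C.Nonempty)
    (hleaf : ∀ x ∈ C, ∀ w ∈ x.1.ends, ∃ y ∈ C, y ≠ x ∧ w ∈ y.1.ends) : C = range e := by
  have hsucc : ∀ i, e i ∈ C → e (i + 1) ∈ C := by
    intro i hi
    obtain ⟨y, hy, hne, hmem⟩ := hleaf _ hi (v (i + 1)) (h.mem_ends_iff.2 (Or.inr rfl))
    obtain ⟨j, rfl⟩ := hC hy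
    rcases h.mem_ends_iff.1 hmem with h1 | h1
    · rwa [h1]
    · exact (hne (congrArg e (add_right_cancel h1).symm)).elim
  have hpred : ∀ i, e i ∈ C → e (i - 1) ∈ C := by
    intro i hi
    obtain ⟨y, hy, hne, hmem⟩ := hleaf _ hi (v i) (h.mem_ends_iff.2 (Or.inl rfl))
    obtain ⟨j, rfl⟩ := hC hy
    rcases h.mem_ends_iff.1 hmem with h1 | h1
    · exact (hne (congrArg e h1.symm)).elim
    · rwa [h1, add_sub_cancel_right]
  obtain ⟨x, hx⟩ := hne
  obtain ⟨i, rfl⟩ := hC hx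
  -- Unit steps reach every index because the integers surject onto `G`; this is what `ZMod n` and
  -- `ℤ` have in common.
  have hall : ∀ z : ℤ, e (i + z) ∈ C := by
    intro z
    induction z using Int.induction_on with
    | zero => simpa using hx
    | succ n ih => simpa [add_assoc] using hsucc _ ih
    | pred n ih => simpa [add_sub_assoc] using hpred _ ih
  refine hC.antisymm ?_
  rintro _ ⟨j, rfl⟩
  obtain ⟨z, hz⟩ := h.cast_surjective (j - i)
  have := hall z
  rwa [hz, add_sub_cancel] at this

end IsCyclicPath

lemma exists_isCyclicPath {C : Set (LadderEdge × Bool)}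
    (hC : doubledLadder.IsFiniteCycleSet C ∨ doubledLadder.IsDoubleRaySet C) :
    ∃ (G : Type) (_ : CommRing G) (v : G → ℕ × Bool) (e : G → LadderEdge × Bool),
      IsCyclicPath G v e ∧ C = range e := by
  rcases hC with ⟨n, -, v, e, hv, he, hl, rfl⟩ | ⟨v, e, hv, hl, rfl⟩
  · exact ⟨ZMod n, inferInstance, v, e, ⟨ZMod.intCast_surjective, hv, he, hl⟩, rfl⟩
  · refine ⟨ℤ, inferInstance, v, e, ⟨fun z => ⟨z, rfl⟩, hv, fun i j hij => ?_, hl⟩, rfl⟩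
    have hends : ∀ i, s(v i, v (i + 1)) = (e i).1.ends := hl
    have h : s(v i, v (i + 1)) = s(v j, v (j + 1)) := by rw [hends, hends, hij]
    rw [Sym2.eq_iff, hv.eq_iff, hv.eq_iff, hv.eq_iff, hv.eq_iff] at h
    omega

/-- The algebraic cycle matroid of the doubled ladder. -/
noncomputable def doubledLadderMatroid : Matroid (LadderEdge × Bool) :=
  ladderMatroid.comap Prod.fst

lemma doubledLadderMatroid_indep_iff {I : Set (LadderEdge × Bool)} :
    doubledLadderMatroid.Indep I ↔ RaylessForest (Prod.fst '' I) ∧ InjOn Prod.fst I := by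
  rw [doubledLadderMatroid, Matroid.comap_indep_iff, ladderMatroid_indep_iff]

@[simp] lemma doubledLadderMatroid_ground : doubledLadderMatroid.E = univ := rfl

lemma IsCyclicPath.not_indep {G : Type} [CommRing G] {v : G → ℕ × Bool}
    {e : G → LadderEdge × Bool} (h : IsCyclicPath G v e) :
    ¬ doubledLadderMatroid.Indep (range e) := by
  rw [doubledLadderMatroid_indep_iff]
  rintro ⟨hF, hinj⟩
  refine not_raylessForest_of_no_leaf ⟨(e 0).1, mem_image_of_mem _ (mem_range_self 0)⟩ ?_ hF
  rintro _ ⟨x, hx, rfl⟩ w hw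
  obtain ⟨y, hy, hyx, hwy⟩ := h.no_leaf hx hw
  exact ⟨y.1, mem_image_of_mem _ hy, fun h => hyx (hinj hy hx h), hwy⟩

lemma isFiniteCycleSet_pair {x : LadderEdge} {b c : Bool} (hbc : b ≠ c) :
    doubledLadder.IsFiniteCycleSet {(x, b), (x, c)} := by
  obtain ⟨p, q, hpq, hne⟩ : ∃ p q, s(p, q) = x.ends ∧ p ≠ q := by
    have := not_isDiag_ends x
    induction h : x.ends with
    | _ p q => exact ⟨p, q, rfl, by simpa [h] using this⟩
  let v : Fin 2 → ℕ × Bool := ![p, q]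
  let e : Fin 2 → LadderEdge × Bool := ![(x, b), (x, c)]
  refine ⟨2, by norm_num, v, e, ?_, ?_, ?_, ?_⟩
  · intro i j hij
    change Fin 2 at i j
    fin_cases i <;> fin_cases j <;> simp_all [v] <;> rfl
  · intro i j hij
    change Fin 2 at i j
    fin_cases i <;> fin_cases j <;> simp_all [e] <;> rfl
  · intro i
    change Fin 2 at i
    rw [doubledLadder_isLink_iff]
    fin_cases i
    · exact hpq
    · exact Sym2.eq_swap.trans hpq
  · change _ = range e
    simp [e, pair_comm]

/-- The vertices of the cycle of the ladder between the columns `i` and `i + l`. -/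
def cycleVertex (i l t : ℕ) : ℕ × Bool :=
  if t ≤ l then (i + t, true) else (i + (2 * l + 1 - t), false)

/-- The edges of the cycle of the ladder between the columns `i` and `i + l`. -/
def cycleEdge (i l t : ℕ) : LadderEdge :=
  if t < l then .u (i + t) else if t = l then .r (i + l)
  else if t < 2 * l + 1 then .d (i + (2 * l - t)) else .r i

lemma cycleEdge_ends {i l t : ℕ} (hl : 0 < l) (ht : t < 2 * l + 2) :
    s(cycleVertex i l t, cycleVertex i l ((t + 1) % (2 * l + 2))) = (cycleEdge i l t).ends := by
  rcases Nat.lt_or_eq_of_le (show t + 1 ≤ 2 * l + 2 by omega) with h | h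
  · rw [Nat.mod_eq_of_lt h]
    unfold cycleVertex cycleEdge
    split_ifs <;> first | omega | (simp [ends]; try grind)
  · rw [h, Nat.mod_self]
    obtain rfl : t = 2 * l + 1 := by omega
    unfold cycleVertex cycleEdge
    split_ifs <;> first | omega | (simp [ends]; try grind)

lemma isFiniteCycleSet_of_rails {i l : ℕ} (hl : 0 < l) (c : LadderEdge → Bool) :
    doubledLadder.IsFiniteCycleSet
      (range fun t : ZMod (2 * l + 2) => (cycleEdge i l t.val, c (cycleEdge i l t.val))) := by
  refine ⟨2 * l + 2, by omega, fun t => cycleVertex i l t.val, _, ?_, ?_, ?_, rfl⟩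
  · intro s t hst
    have hs := ZMod.val_lt s
    have ht := ZMod.val_lt t
    apply ZMod.val_injective
    simp only [cycleVertex] at hst
    split_ifs at hst <;> grind
  · intro s t hst
    have hs := ZMod.val_lt s
    have ht := ZMod.val_lt t
    apply ZMod.val_injective
    simp only [Prod.mk.injEq] at hst
    have h := hst.1
    simp only [cycleEdge] at h
    split_ifs at h <;> grind
  · intro t
    rw [doubledLadder_isLink_iff]
    simp only
    rw [← cycleEdge_ends hl (ZMod.val_lt t), ZMod.val_add, ZMod.val_one_eq_one_mod,
      Nat.add_mod_mod]

/-- The vertices of the double ray of the ladder that contains the rung `r i`. -/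
def rayVertex (i : ℕ) (t : ℤ) : ℕ × Bool :=
  if 0 ≤ t then (i + t.toNat, true) else (i + (-1 - t).toNat, false)

/-- The edges of the double ray of the ladder that contains the rung `r i`. -/
def rayEdge (i : ℕ) (t : ℤ) : LadderEdge :=
  if 0 ≤ t then .u (i + t.toNat) else if t = -1 then .r i else .d (i + (-2 - t).toNat)

lemma isDoubleRaySet_of_rails (i : ℕ) (c : LadderEdge → Bool) :
    doubledLadder.IsDoubleRaySet (range fun t : ℤ => (rayEdge i t, c (rayEdge i t))) := by
  refine ⟨rayVertex i, _, ?_, ?_, rfl⟩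
  · intro s t hst
    simp only [rayVertex] at hst
    split_ifs at hst <;> grind
  · intro t
    rw [doubledLadder_isLink_iff]
    unfold rayVertex rayEdge
    split_ifs <;> first | omega | (simp [ends]; try grind)

lemma exists_subset_of_not_indep {I : Set (LadderEdge × Bool)}
    (hI : ¬ doubledLadderMatroid.Indep I) :
    ∃ C ⊆ I, doubledLadder.IsFiniteCycleSet C ∨ doubledLadder.IsDoubleRaySet C := by
  classical
  by_cases hinj : InjOn Prod.fst I
  · have hF : ¬ RaylessForest (Prod.fst '' I) := fun h =>
      hI (doubledLadderMatroid_indep_iff.2 ⟨h, hinj⟩)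
    -- `c` selects a copy lying in `I`: the clone if it is there, otherwise the original.
    let c : LadderEdge → Bool := fun x => decide ((x, true) ∈ I)
    have hc : ∀ x ∈ Prod.fst '' I, (x, c x) ∈ I := by
      rintro _ ⟨⟨x, b⟩, hx, rfl⟩
      by_cases h : (x, true) ∈ I
      · simp [c, h]
      · cases b
        · simpa [c, h] using hx
        · exact (h hx).elim
    by_cases hR : Forest (Prod.fst '' I)
    · obtain ⟨i, hi, hrails⟩ : ∃ i, r i ∈ Prod.fst '' I ∧ ∀ k, i ≤ k → Rails (Prod.fst '' I) k := by
        by_contra! h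
        exact hF ⟨hR, fun i hi hk => by obtain ⟨k, h1, h2⟩ := h i hi; exact h2 (hk k h1)⟩
      refine ⟨_, ?_, Or.inr (isDoubleRaySet_of_rails i c)⟩
      rintro _ ⟨t, rfl⟩
      apply hc
      unfold rayEdge
      split_ifs
      · exact (hrails _ (by omega)).1
      · exact hi
      · exact (hrails _ (by omega)).2
    · unfold Forest at hR
      push Not at hR
      obtain ⟨i, j, hij, hi, hj, hrails⟩ := hR
      obtain ⟨l, rfl⟩ := Nat.exists_eq_add_of_lt hij
      refine ⟨_, ?_, Or.inl (isFiniteCycleSet_of_rails (i := i) (Nat.succ_pos l) c)⟩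
      rintro _ ⟨t, rfl⟩
      have := ZMod.val_lt t
      apply hc
      unfold cycleEdge
      split_ifs
      · exact (hrails _ (by omega) (by omega)).1
      · exact hj
      · exact (hrails _ (by omega) (by omega)).2
      · exact hi
  · unfold InjOn at hinj
    push Not at hinj
    obtain ⟨⟨x, b⟩, hx, ⟨y, c⟩, hy, h1, h2⟩ := hinj
    obtain rfl : x = y := h1
    refine ⟨{(x, b), (x, c)}, ?_, Or.inl (isFiniteCycleSet_pair fun h => h2 (by rw [h]))⟩
    rintro _ (rfl | rfl)
    · exact hx
    · exact hy

/-- Every dependent set contains a cycle or double ray. These have no leaf, and a nonempty leafless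
part of a cyclic path is the whole path, so they are exactly the minimal dependent sets. -/
lemma isAlgebraicCycleMatroid_doubledLadderMatroid :
    doubledLadderMatroid.IsAlgebraicCycleMatroid doubledLadder where
  ground_eq := by
    ext e
    simp [doubledLadder, Graph.double, ladder]
  isCircuit_iff C := by
    rw [Matroid.isCircuit_iff_minimal_not_indep (by simp)]
    constructor
    · intro hC
      obtain ⟨C', hC', h⟩ := exists_subset_of_not_indep hC.prop
      obtain ⟨G, _, v, e, hp, rfl⟩ := exists_isCyclicPath h
      rwa [hC.eq_of_subset hp.not_indep hC'] at h
    · intro hC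
      obtain ⟨G, _, v, e, hp, rfl⟩ := exists_isCyclicPath hC
      refine ⟨hp.not_indep, fun I hI hIC => ?_⟩
      obtain ⟨C', hC', h⟩ := exists_subset_of_not_indep hI
      obtain ⟨G', _, v', e', hp', rfl⟩ := exists_isCyclicPath h
      have := hp.eq_of_subset (hC'.trans hIC) ⟨_, mem_range_self 0⟩ fun x hx w => hp'.no_leaf hx
      exact (this.symm.subset.trans hC' : range e ⊆ I)

end DoubledLadder

/-! ### Finite augmentation for matroid unions. -/

section MatroidUnion

open Set

/-- Augmentation for unions of two independent sets of a matroid. -/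
lemma Matroid.exists_insert_union_of_encard_lt {α : Type*} (M : Matroid α) {I J : Set α}
    (hJfin : J.Finite) (hI : ∃ I₁ I₂, M.Indep I₁ ∧ M.Indep I₂ ∧ I = I₁ ∪ I₂)
    (hJ : ∃ J₁ J₂, M.Indep J₁ ∧ M.Indep J₂ ∧ J = J₁ ∪ J₂) (hlt : I.encard < J.encard) :
    ∃ e ∈ J, e ∉ I ∧ ∃ I₁ I₂, M.Indep I₁ ∧ M.Indep I₂ ∧ insert e I = I₁ ∪ I₂ := by
  obtain ⟨J₁, J₂, hJ₁, hJ₂, hJd, rfl⟩ :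
      ∃ J₁ J₂, M.Indep J₁ ∧ M.Indep J₂ ∧ Disjoint J₁ J₂ ∧ J = J₁ ∪ J₂ := by
    obtain ⟨J₁, J₂, h1, h2, rfl⟩ := hJ
    exact ⟨J₁, J₂ \ J₁, h1, h2.subset sdiff_subset, disjoint_sdiff_right, by simp⟩
  have hIfin : I.Finite := by
    rw [← encard_lt_top_iff]
    exact hlt.trans_le le_top
  by_contra! hcon
  -- Induction on the number of elements of `I` lying on the wrong side relative to `J₁` and `J₂`.
  -- An element of `J₁` that augments `I₁` is either new to `I`, or it can be moved from `I₂` to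
  -- `I₁`, which lowers that number.
  have key : ∀ n : ℕ, ∀ I₁ I₂, M.Indep I₁ → M.Indep I₂ → Disjoint I₁ I₂ → I = I₁ ∪ I₂ →
      (I₁ ∩ J₂).ncard + (I₂ ∩ J₁).ncard = n → False := by
    intro n
    induction n using Nat.strong_induction_on with
    | _ n ih =>
    intro I₁ I₂ hI₁ hI₂ hId hIU hn
    wlog hlt₁ : I₁.encard < J₁.encard generalizing I₁ I₂ J₁ J₂
    · refine this J₂ J₁ hJ₂ hJ₁ hJd.symm (by rwa [union_comm]) ?_ ?_ ?_ ?_ I₂ I₁ hI₂ hI₁ hId.symm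
        (by rwa [union_comm]) (by omega) ?_
      · rwa [union_comm]
      · rwa [union_comm]
      · rwa [union_comm]
      · intro m hm K₁ K₂ h1 h2 h3 h4 h5
        exact ih m hm K₂ K₁ h2 h1 h3.symm (by rwa [union_comm]) (by omega)
      · by_contra hle
        rw [hIU, encard_union_eq hId, encard_union_eq hJd] at hlt
        exact (add_le_add (not_lt.1 hlt₁) (not_lt.1 hle)).not_gt hlt
    obtain ⟨e, ⟨heJ, heI⟩, hins⟩ := hI₁.augment hJ₁ hlt₁
    by_cases he₂ : e ∈ I₂
    · have heJ₂ : e ∉ J₂ := fun h => hJd.notMem_of_mem_left heJ h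
      have h2 : ((I₂ \ {e}) ∩ J₁).ncard < (I₂ ∩ J₁).ncard := by
        refine ncard_lt_ncard ?_ ((hIfin.subset (hIU ▸ subset_union_right)).inter_of_left _)
        refine ⟨inter_subset_inter_left _ sdiff_subset, fun h => ?_⟩
        exact (h ⟨he₂, heJ⟩).1.2 rfl
      have h1 : insert e I₁ ∩ J₂ = I₁ ∩ J₂ := by
        ext x
        grind
      refine ih _ ?_ (insert e I₁) (I₂ \ {e}) hins (hI₂.subset sdiff_subset) ?_ ?_ rfl
      · rw [h1]
        omega
      · rw [Set.disjoint_left] at hId ⊢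
        grind
      · rw [hIU]
        ext x
        grind
    · exact hcon e (Or.inl heJ) (by rw [hIU]; simp [heI, he₂]) (insert e I₁) I₂ hins hI₂
        (by rw [hIU, insert_union])
  obtain ⟨I₁, I₂, h1, h2, h3⟩ := hI
  exact key _ I₁ (I₂ \ I₁) h1 (h2.subset sdiff_subset) disjoint_sdiff_right (by simp [h3]) rfl

end MatroidUnion

/-! ### The finitary matroid of unions of two forests. -/

namespace LadderEdge

open Set

/-- The edges of `J` can be distributed to `A` and `B` such that neither receives both copies of an
edge. -/
def Covers (J : Set (LadderEdge × Bool)) (A B : Set LadderEdge) : Prop :=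
  ∀ e ∈ J, (e.1 ∈ A ∨ e.1 ∈ B) ∧ ((e.1, !e.2) ∈ J → e.1 ∈ A ∧ e.1 ∈ B)

/-- `J` is covered by two forests. -/
def BiForest (J : Set (LadderEdge × Bool)) : Prop := ∃ A B, Forest A ∧ Forest B ∧ Covers J A B

/-- `J` is covered by two forests without double rays. -/
def BiRaylessForest (J : Set (LadderEdge × Bool)) : Prop :=
  ∃ A B, RaylessForest A ∧ RaylessForest B ∧ Covers J A B

variable {A B : Set LadderEdge} {I J : Set (LadderEdge × Bool)}

lemma Covers.symm (h : Covers J A B) : Covers J B A := fun e he =>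
  ⟨(h e he).1.symm, fun h' => ((h e he).2 h').symm⟩

lemma Covers.mono (h : Covers J A B) (hIJ : I ⊆ J) : Covers I A B := fun e he =>
  ⟨(h e (hIJ he)).1, fun h' => (h e (hIJ he)).2 (hIJ h')⟩

lemma Forest.mono (h : Forest A) (hBA : B ⊆ A) : Forest B := fun i j hij hi hj hk =>
  h i j hij (hBA hi) (hBA hj) fun k h1 h2 => ⟨hBA (hk k h1 h2).1, hBA (hk k h1 h2).2⟩

lemma RaylessForest.mono (h : RaylessForest A) (hBA : B ⊆ A) : RaylessForest B :=
  ⟨h.1.mono hBA, fun i hi hk => h.2 i (hBA hi) fun k h1 => ⟨hBA (hk k h1).1, hBA (hk k h1).2⟩⟩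

lemma BiForest.mono (h : BiForest J) (hIJ : I ⊆ J) : BiForest I := by
  obtain ⟨A, B, hA, hB, hc⟩ := h
  exact ⟨A, B, hA, hB, hc.mono hIJ⟩

lemma BiRaylessForest.mono (h : BiRaylessForest J) (hIJ : I ⊆ J) : BiRaylessForest I := by
  obtain ⟨A, B, hA, hB, hc⟩ := h
  exact ⟨A, B, hA, hB, hc.mono hIJ⟩

lemma BiRaylessForest.biForest (h : BiRaylessForest J) : BiForest J := by
  obtain ⟨A, B, hA, hB, hc⟩ := h
  exact ⟨A, B, hA.1, hB.1, hc⟩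

lemma biRaylessForest_empty : BiRaylessForest ∅ :=
  ⟨∅, ∅, ⟨by simp [Forest], by simp⟩, ⟨by simp [Forest], by simp⟩, by simp [Covers]⟩

lemma Forest.raylessForest_of_finite (h : Forest A) (hfin : A.Finite) : RaylessForest A := by
  refine ⟨h, fun i _ hk => ?_⟩
  refine Set.infinite_of_injective_forall_mem (f := fun n => u (i + n)) ?_
    (fun n => (hk (i + n) (by omega)).1) hfin
  intro m n hmn
  simpa using hmn

lemma Covers.inter (h : Covers J A B) : Covers J (A ∩ Prod.fst '' J) (B ∩ Prod.fst '' J) := by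
  intro e he
  have := mem_image_of_mem Prod.fst he
  have := h e he
  grind

lemma BiForest.biRaylessForest_of_finite (h : BiForest J) (hfin : J.Finite) :
    BiRaylessForest J := by
  obtain ⟨A, B, hA, hB, hc⟩ := h
  have hf : (Prod.fst '' J).Finite := hfin.image _
  exact ⟨_, _, (hA.mono inter_subset_left).raylessForest_of_finite (hf.inter_of_right _),
    (hB.mono inter_subset_left).raylessForest_of_finite (hf.inter_of_right _), hc.inter⟩

lemma biRaylessForest_iff : BiRaylessForest J ↔ ∃ I₁ I₂, doubledLadderMatroid.Indep I₁ ∧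
    doubledLadderMatroid.Indep I₂ ∧ J = I₁ ∪ I₂ := by
  constructor
  · rintro ⟨A, B, hA, hB, hc⟩
    -- An edge in both `A` and `B` gives its original to the first set and its clone to the second.
    refine ⟨{e ∈ J | e.1 ∈ A ∧ (e.1 ∈ B → e.2 = false)},
      {e ∈ J | e.1 ∈ B ∧ (e.1 ∈ A → e.2 = true)}, ?_, ?_, ?_⟩
    · refine doubledLadderMatroid_indep_iff.2 ⟨hA.mono ?_, ?_⟩
      · rintro _ ⟨e, he, rfl⟩
        exact he.2.1
      · rintro ⟨x, b⟩ ⟨hx, h1, h2⟩ ⟨y, c⟩ ⟨hy, h3, h4⟩ hxy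
        have := hc _ hx
        cases b <;> cases c <;> grind
    · refine doubledLadderMatroid_indep_iff.2 ⟨hB.mono ?_, ?_⟩
      · rintro _ ⟨e, he, rfl⟩
        exact he.2.1
      · rintro ⟨x, b⟩ ⟨hx, h1, h2⟩ ⟨y, c⟩ ⟨hy, h3, h4⟩ hxy
        have := hc _ hx
        cases b <;> cases c <;> grind
    · ext ⟨x, b⟩
      constructor
      · intro hx
        have := (hc _ hx).1
        cases b <;> simp_all <;> tauto
      · rintro (h | h)
        · exact h.1
        · exact h.1
  · rintro ⟨I₁, I₂, h1, h2, rfl⟩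
    rw [doubledLadderMatroid_indep_iff] at h1 h2
    refine ⟨_, _, h1.1, h2.1, ?_⟩
    rintro ⟨x, b⟩ hx
    refine ⟨hx.imp (mem_image_of_mem _) (mem_image_of_mem _), fun hx' => ?_⟩
    have hne : (x, b) ≠ (x, !b) := by simp
    rcases hx with hx | hx <;> rcases hx' with hx' | hx'
    · exact (hne (h1.2 hx hx' rfl)).elim
    · exact ⟨⟨_, hx, rfl⟩, ⟨_, hx', rfl⟩⟩
    · exact ⟨⟨_, hx', rfl⟩, ⟨_, hx, rfl⟩⟩
    · exact (hne (h2.2 hx hx' rfl)).elim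

/-- Compactness: the two forests are ultrafilter limits of forests for the finite parts of `J`. A
finite cycle in a limit already occurs at some finite stage; a double ray need not. -/
lemma biForest_of_finite_subsets (h : ∀ I ⊆ J, I.Finite → BiForest I) : BiForest J := by
  classical
  choose! A B hA hB hc using h
  let 𝓕 : Ultrafilter (Finset (LadderEdge × Bool)) := Ultrafilter.of Filter.atTop
  have hle : (𝓕 : Filter (Finset (LadderEdge × Bool))) ≤ Filter.atTop := Ultrafilter.of_le _
  let P : Finset (LadderEdge × Bool) → Set (LadderEdge × Bool) := fun s => J ∩ s
  have hfin : ∀ s, (P s).Finite := fun s => s.finite_toSet.inter_of_right J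
  have hmem : ∀ e ∈ J, ∀ᶠ s in (𝓕 : Filter (Finset (LadderEdge × Bool))), e ∈ P s := by
    intro e he
    refine hle ?_
    filter_upwards [Filter.eventually_ge_atTop {e}] with s hs
    exact ⟨he, by simpa using hs⟩
  have hlim : ∀ D : Set (LadderEdge × Bool) → Set LadderEdge, (∀ s, Forest (D (P s))) →
      Forest {x | ∀ᶠ s in (𝓕 : Filter (Finset (LadderEdge × Bool))), x ∈ D (P s)} := by
    intro D hD i j hij hi hj hk
    have hall : ∀ᶠ s in (𝓕 : Filter (Finset (LadderEdge × Bool))),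
        ∀ k ∈ Finset.Ico i j, Rails (D (P s)) k := by
      rw [Filter.eventually_all_finset]
      intro k hk'
      rw [Finset.mem_Ico] at hk'
      exact (hk k hk'.1 hk'.2).1.and (hk k hk'.1 hk'.2).2
    obtain ⟨s, ⟨hs1, hs2⟩, hs3⟩ := ((Filter.Eventually.and hi hj).and hall).exists
    exact hD s i j hij hs1 hs2 fun k h1 h2 => hs3 k (Finset.mem_Ico.2 ⟨h1, h2⟩)
  refine ⟨_, _, hlim A fun s => hA _ inter_subset_left (hfin s),
    hlim B fun s => hB _ inter_subset_left (hfin s), fun e he => ⟨?_, fun he' => ?_⟩⟩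
  · refine Ultrafilter.eventually_or.1 ?_
    filter_upwards [hmem e he] with s hs
    exact (hc _ inter_subset_left (hfin s) e hs).1
  · refine Filter.eventually_and.1 ?_
    filter_upwards [hmem e he, hmem _ he'] with s hs hs'
    exact (hc _ inter_subset_left (hfin s) e hs).2 hs'

/-- The finitary matroid whose independent sets are the unions of two forests. -/
def biForestMatroid : Matroid (LadderEdge × Bool) :=
  (IndepMatroid.ofFinitaryCardAugment univ BiForest biRaylessForest_empty.biForest
    (fun _ _ h hs => h.mono hs)
    (by
      intro I J hI hIf hJ hJf hlt
      obtain ⟨e, h1, h2, h3⟩ := doubledLadderMatroid.exists_insert_union_of_encard_lt hJf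
        (biRaylessForest_iff.1 (hI.biRaylessForest_of_finite hIf))
        (biRaylessForest_iff.1 (hJ.biRaylessForest_of_finite hJf))
        (by rwa [← hIf.cast_ncard_eq, ← hJf.cast_ncard_eq, Nat.cast_lt])
      exact ⟨e, h1, h2, (biRaylessForest_iff.2 h3).biForest⟩)
    (fun _ h => biForest_of_finite_subsets h)
    (fun _ _ => subset_univ _)).matroid

/-! ### Removing double rays when no tail of rails is full. -/

/-- `x` is one of the two rails between the columns `k` and `k + 1`. -/
def IsRail (x : LadderEdge) (k : ℕ) : Prop := x = u k ∨ x = d k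

lemma rails_iff {k : ℕ} : Rails A k ↔ ∀ x, IsRail x k → x ∈ A := by
  simp [Rails, IsRail]

/-- `J` contains all copies of the rails from column `n` on. -/
def RailTail (n : ℕ) (J : Set (LadderEdge × Bool)) : Prop :=
  ∀ k, n ≤ k → ∀ x, IsRail x k → ∀ b, (x, b) ∈ J

lemma RailTail.mono {n : ℕ} (h : RailTail n I) (hIJ : I ⊆ J) : RailTail n J :=
  fun k hk x hx b => hIJ (h k hk x hx b)

lemma RailTail.rails {n : ℕ} (h : RailTail n J) (hc : Covers J A B) {k : ℕ} (hk : n ≤ k) :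
    Rails A k := by
  rw [rails_iff]
  intro x hx
  exact ((hc _ (h k hk x hx true)).2 (h k hk x hx false)).1

-- Call a column a gap if `B` misses a rail there. Past `n`, the rungs of `D` are rungs of `B` in
-- blocks of parity `p`, and `D` also misses a rail at the gap opening each such block. So a cycle
-- of `D` ending past `n` stays inside one block, where it would be a cycle of `B`. Gaps of parity
-- `p` recur forever, which excludes double rays.
open Classical in
lemma raylessForest_of_parity {D D₀ : Set LadderEdge} {n : ℕ} {p : ℕ → Prop}
    (hp : ∀ m, p m ∨ p (m + 1)) (hB : Forest B) (hBinf : ∀ m, ∃ k, m ≤ k ∧ ¬ Rails B k)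
    (hn : ¬ Rails B n) (hD₀ : Forest D₀) (hrung₀ : ∀ j ≤ n, r j ∈ D → r j ∈ D₀)
    (hrails₀ : ∀ k < n, Rails D k → Rails D₀ k)
    (hrung : ∀ j, n < j → r j ∈ D → r j ∈ B ∧ p (Nat.count (fun k => ¬ Rails B k) j))
    (hrails : ∀ k, n ≤ k → ¬ Rails B k → p (Nat.count (fun k => ¬ Rails B k) (k + 1)) →
      ¬ Rails D k) : RaylessForest D := by
  constructor
  · intro i j hij hi hj hk
    by_cases hjn : j ≤ n
    · exact hD₀ i j hij (hrung₀ i (by omega) hi) (hrung₀ j hjn hj)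
        fun k h1 h2 => hrails₀ k (by omega) (hk k h1 h2)
    · rw [not_le] at hjn
      have hlast : ∃ k, n ≤ k ∧ k < j ∧ ¬ Rails B k ∧ ∀ l, k < l → l < j → Rails B l := by
        have hne : ((Finset.Ico n j).filter fun k => ¬ Rails B k).Nonempty :=
          ⟨n, by simp [hn, hjn]⟩
        have hmem := Finset.max'_mem _ hne
        simp only [Finset.mem_filter, Finset.mem_Ico] at hmem
        refine ⟨_, hmem.1.1, hmem.1.2, hmem.2, fun l h1 h2 => ?_⟩
        by_contra h3
        have := Finset.le_max' ((Finset.Ico n j).filter fun k => ¬ Rails B k) l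
          (by simp only [Finset.mem_filter, Finset.mem_Ico]; exact ⟨⟨by omega, h2⟩, h3⟩)
        omega
      obtain ⟨k, hnk, hkj, hBk, hl⟩ := hlast
      have hcount : ∀ m, k + 1 ≤ m → m ≤ j → Nat.count (fun k => ¬ Rails B k) m =
          Nat.count (fun k => ¬ Rails B k) (k + 1) := by
        intro m hm
        induction m, hm using Nat.le_induction with
        | base => exact fun _ => rfl
        | succ m hm ih =>
          intro h
          rw [Nat.count_succ, ih (by omega), if_neg (by simpa using hl m (by omega) (by omega))]
          simp
      obtain ⟨hjB, hpj⟩ := hrung j hjn hj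
      rw [hcount j (by omega) le_rfl] at hpj
      have hik : k < i := by
        by_contra h
        exact hrails k hnk hBk hpj (hk k (by omega) hkj)
      exact hB i j hij (hrung i (by omega) hi).1 hjB fun l h1 h2 => hl l (by omega) h2
  · intro i hi hk
    have hex : ∃ k, i ≤ k ∧ n ≤ k ∧ ¬ Rails B k ∧
        p (Nat.count (fun k => ¬ Rails B k) (k + 1)) := by
      obtain ⟨k, h1, h2⟩ := hBinf (max i n)
      rcases hp (Nat.count (fun k => ¬ Rails B k) (k + 1)) with h | h
      · exact ⟨k, by omega, by omega, h2, h⟩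
      · have hnext := hBinf (k + 1)
        obtain ⟨h3, h4⟩ := Nat.find_spec hnext
        have hcount : ∀ m, k + 1 ≤ m → m ≤ Nat.find hnext →
            Nat.count (fun k => ¬ Rails B k) m = Nat.count (fun k => ¬ Rails B k) (k + 1) := by
          intro m hm
          induction m, hm using Nat.le_induction with
          | base => exact fun _ => rfl
          | succ m hm ih =>
            intro h
            have hmin := Nat.find_min hnext (m := m) (by omega)
            rw [Nat.count_succ, ih (by omega), if_neg fun h' => hmin ⟨hm, h'⟩]
            simp
        refine ⟨Nat.find hnext, by omega, by omega, h4, ?_⟩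
        rw [Nat.count_succ, hcount _ h3 le_rfl, if_pos h4]
        exact h
    obtain ⟨k, h1, h2, h3, h4⟩ := hex
    exact hrails k h2 h3 h4 (hk k h1)

/-- If the forest `A` has finitely many rungs and the forest `B` misses infinitely many rails, then
`A` and `B` can be re-divided into two forests without double rays. -/
lemma exists_exchange_raylessForest {n : ℕ} (hA : Forest A) (hB : Forest B)
    (hBinf : ∀ m, ∃ k, m ≤ k ∧ ¬ Rails B k) (hn : ¬ Rails B n)
    (hArung : ∀ j, n < j → r j ∉ A) :
    ∃ A' B', RaylessForest A' ∧ RaylessForest B' ∧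
      ∀ x, ((x ∈ A' ∨ x ∈ B') ↔ (x ∈ A ∨ x ∈ B)) ∧ ((x ∈ A' ∧ x ∈ B') ↔ (x ∈ A ∧ x ∈ B)) := by
  classical
  let c : ℕ → ℕ := Nat.count (fun k => ¬ Rails B k)
  -- The gaps of `B` cut the ladder into blocks, and `A` and `B` trade places on the odd blocks from
  -- `n` on. Using `c (k + 1)` for rails puts a gap into the block on its right.
  let T : Set LadderEdge := {x | (∃ k, IsRail x k ∧ n ≤ k ∧ Odd (c (k + 1))) ∨
    ∃ j, x = r j ∧ n < j ∧ Odd (c j)}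
  have hTr : ∀ j, r j ∈ T ↔ n < j ∧ Odd (c j) := by
    intro j
    simp [T, IsRail]
  have hTu : ∀ k, u k ∈ T ↔ n ≤ k ∧ Odd (c (k + 1)) := by
    intro j
    simp [T, IsRail]
  have hTd : ∀ k, d k ∈ T ↔ n ≤ k ∧ Odd (c (k + 1)) := by
    intro j
    simp [T, IsRail]
  refine ⟨{x | (x ∈ T → x ∈ B) ∧ (x ∉ T → x ∈ A)}, {x | (x ∈ T → x ∈ A) ∧ (x ∉ T → x ∈ B)},
    raylessForest_of_parity (p := Odd) (n := n) (D₀ := A) ?_ hB hBinf hn hA ?_ ?_ ?_ ?_,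
    raylessForest_of_parity (p := Even) (n := n) (D₀ := B) ?_ hB hBinf hn hB ?_ ?_ ?_ ?_, ?_⟩
  · intro m
    rcases Nat.even_or_odd m with h | h
    · exact Or.inr h.add_one
    · exact Or.inl h
  · intro j hj h
    exact h.2 (by simp [hTr, hj])
  · intro k hk h
    exact ⟨h.1.2 (by simp [hTu, hk]), h.2.2 (by simp [hTd, hk])⟩
  · intro j hj h
    have hT : r j ∈ T := by
      by_contra hT
      exact hArung j hj (h.2 hT)
    exact ⟨h.1 hT, ((hTr j).1 hT).2⟩
  · intro k hk hBk hodd h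
    exact hBk ⟨h.1.1 ((hTu k).2 ⟨hk, hodd⟩), h.2.1 ((hTd k).2 ⟨hk, hodd⟩)⟩
  · intro m
    rcases Nat.even_or_odd m with h | h
    · exact Or.inl h
    · exact Or.inr h.add_one
  · intro j hj h
    exact h.2 (by simp [hTr, hj])
  · intro k hk h
    exact ⟨h.1.2 (by simp [hTu, hk]), h.2.2 (by simp [hTd, hk])⟩
  · intro j hj h
    have hT : r j ∉ T := by
      intro hT
      exact hArung j hj (h.1 hT)
    refine ⟨h.2 hT, ?_⟩
    rw [hTr, not_and, Nat.not_odd_iff_even] at hT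
    exact hT hj
  · intro k hk hBk heven h
    rw [← Nat.not_odd_iff_even] at heven
    exact hBk ⟨h.1.2 (by rw [hTu]; tauto), h.2.2 (by rw [hTd]; tauto)⟩
  · intro x
    simp only [mem_ofPred_eq]
    by_cases hx : x ∈ T <;> simp only [hx] <;> tauto

lemma biRaylessForest_of_not_raylessForest_left (hA : Forest A) (hB : Forest B)
    (hc : Covers J A B) (hJ : ∀ n, ¬ RailTail n J) (hAR : ¬ RaylessForest A) :
    BiRaylessForest J := by
  obtain ⟨i, hi, hrails⟩ : ∃ i, r i ∈ A ∧ ∀ k, i ≤ k → Rails A k := by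
    by_contra! h
    exact hAR ⟨hA, fun i hi hk => by obtain ⟨k, h1, h2⟩ := h i hi; exact h2 (hk k h1)⟩
  have hrung : ∀ j, i < j → r j ∉ A := fun j hj h => hA i j hj hi h fun k h1 _ => hrails k h1
  -- Thinning `B` so that an edge in both forests has both copies in `J`. As `A` contains all rails
  -- from `i` on, every copy of a rail missing from `J` there becomes a gap of `B₀`.
  let B₀ : Set LadderEdge := {x ∈ B | x ∈ A → ∀ b, (x, b) ∈ J}
  have hB₀ : Forest B₀ := hB.mono fun x hx => hx.1
  have hc₀ : Covers J A B₀ := by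
    rintro ⟨x, b⟩ hx
    obtain ⟨h1, h2⟩ := hc _ hx
    refine ⟨?_, fun hx' => ⟨(h2 hx').1, (h2 hx').2, fun _ c => ?_⟩⟩
    · by_cases hxA : x ∈ A
      · exact Or.inl hxA
      · exact Or.inr ⟨h1.resolve_left hxA, fun h => (hxA h).elim⟩
    · cases b <;> cases c <;> assumption
  have hinf : ∀ m, ∃ k, m ≤ k ∧ i ≤ k ∧ ¬ Rails B₀ k := by
    intro m
    have := hJ (max m i)
    unfold RailTail at this
    push Not at this
    obtain ⟨k, hk, x, hx, b, hb⟩ := this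
    refine ⟨k, by omega, by omega, fun h => hb ?_⟩
    exact ((rails_iff.1 h x hx).2 (rails_iff.1 (hrails k (by omega)) x hx) b)
  obtain ⟨n, -, hin, hn⟩ := hinf 0
  obtain ⟨A', B', hA', hB', hx⟩ := exists_exchange_raylessForest hA hB₀
    (fun m => by obtain ⟨k, h1, -, h2⟩ := hinf m; exact ⟨k, h1, h2⟩) hn
    (fun j hj => hrung j (by omega))
  refine ⟨A', B', hA', hB', fun e he => ?_⟩
  rw [(hx e.1).1, (hx e.1).2]
  exact hc₀ e he

/-- A union of two forests that misses infinitely many rails is a union of two forests without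
double rays. -/
lemma BiForest.biRaylessForest (h : BiForest J) (hJ : ∀ n, ¬ RailTail n J) :
    BiRaylessForest J := by
  obtain ⟨A, B, hA, hB, hc⟩ := h
  by_cases hAR : RaylessForest A
  · by_cases hBR : RaylessForest B
    · exact ⟨A, B, hAR, hBR, hc⟩
    · exact biRaylessForest_of_not_raylessForest_left hB hA hc.symm hJ hBR
  · exact biRaylessForest_of_not_raylessForest_left hA hB hc hJ hAR

/-! ### Full tails of rails: trading double rays for a pair of rungs. -/

/-- Both copies of the rung `r m`. -/
def rungPair (m : ℕ) : Set (LadderEdge × Bool) := {e | e.1 = r m}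

lemma RaylessForest.rung_notMem {n : ℕ} (hA : RaylessForest A) (hn : ∀ k, n ≤ k → Rails A k)
    {m : ℕ} (hm : n ≤ m) : r m ∉ A :=
  fun h => hA.2 m h fun k hk => hn k (hm.trans hk)

/-- Since `A` has no rung from column `n` on, a cycle through the new rung would have its other rung
further left; replacing the new rung by the rails beyond it would give a double ray in `A`. -/
lemma RaylessForest.forest_insert_rung {n : ℕ} (hA : RaylessForest A)
    (hn : ∀ k, n ≤ k → Rails A k) {m : ℕ} (hm : n ≤ m) : Forest (insert (r m) A) := by
  intro i j hij hi hj hk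
  have hk' : ∀ k, i ≤ k → k < j → Rails A k := by
    intro k h1 h2
    simpa [Rails] using hk k h1 h2
  have hrung : ∀ j, n ≤ j → r j ∉ A := fun j hj => hA.rung_notMem hn hj
  rcases hi with hi | hi <;> rcases hj with hj | hj
  · simp_all
  · obtain rfl : i = m := by simpa using hi
    exact hrung j (by omega) hj
  · obtain rfl : j = m := by simpa using hj
    refine hA.2 i hi fun k h1 => ?_
    by_cases h2 : k < j
    · exact hk' k h1 h2
    · exact hn k (by omega)
  · exact hA.1 i j hij hi hj hk'

lemma BiRaylessForest.disjoint_rungPair (h : BiRaylessForest J) {n m : ℕ} (hJ : RailTail n J)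
    (hm : n ≤ m) : Disjoint J (rungPair m) := by
  obtain ⟨A, B, hA, hB, hc⟩ := h
  rw [Set.disjoint_left]
  intro e he (h : e.1 = r m)
  rcases (hc e he).1 with h' | h'
  · exact hA.rung_notMem (fun k hk => hJ.rails hc hk) hm (h ▸ h')
  · exact hB.rung_notMem (fun k hk => hJ.rails hc.symm hk) hm (h ▸ h')

lemma BiRaylessForest.biForest_union_rungPair (h : BiRaylessForest J) {n m : ℕ}
    (hJ : RailTail n J) (hm : n ≤ m) : BiForest (J ∪ rungPair m) := by
  obtain ⟨A, B, hA, hB, hc⟩ := h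
  refine ⟨_, _, hA.forest_insert_rung (fun k hk => hJ.rails hc hk) hm,
    hB.forest_insert_rung (fun k hk => hJ.rails hc.symm hk) hm, fun e he => ?_⟩
  by_cases h : e.1 = r m
  · simp [h]
  · have h1 : e ∈ J := he.resolve_right h
    refine ⟨(hc e h1).1.imp (mem_insert_of_mem _) (mem_insert_of_mem _), fun h2 => ?_⟩
    have h3 := (hc e h1).2 (h2.resolve_right h)
    exact ⟨mem_insert_of_mem _ h3.1, mem_insert_of_mem _ h3.2⟩

/-- A double ray through any other rung would already close a finite cycle of `A` with `r m`. -/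
lemma Forest.raylessForest_sdiff_rung (hA : Forest A) {n m : ℕ} (hn : ∀ k, n ≤ k → Rails A k)
    (hm : n ≤ m) (hrm : r m ∈ A) : RaylessForest (A \ {r m}) := by
  refine ⟨hA.mono sdiff_subset, fun i hi hk => ?_⟩
  have hk' : ∀ k, i ≤ k → Rails A k := fun k h => ⟨(hk k h).1.1, (hk k h).2.1⟩
  rcases lt_trichotomy i m with h | rfl | h
  · exact hA i m h hi.1 hrm fun k h1 _ => hk' k h1
  · exact hi.2 rfl
  · exact hA m i h hrm hi.1 fun k h1 _ => hn k (by omega)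

lemma BiForest.biRaylessForest_of_union_rungPair {n m : ℕ} (h : BiForest (J ∪ rungPair m))
    (hJ : RailTail n J) (hm : n ≤ m) (hd : Disjoint J (rungPair m)) : BiRaylessForest J := by
  obtain ⟨A, B, hA, hB, hc⟩ := h
  have hJ' := hJ.mono (subset_union_left (t := rungPair m))
  have hr : r m ∈ A ∧ r m ∈ B := (hc (r m, true) (Or.inr rfl)).2 (Or.inr rfl)
  refine ⟨_, _, hA.raylessForest_sdiff_rung (fun k hk => hJ'.rails hc hk) hm hr.1,
    hB.raylessForest_sdiff_rung (fun k hk => hJ'.rails hc.symm hk) hm hr.2, fun e he => ?_⟩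
  have h1 : e.1 ≠ r m := fun h => Set.disjoint_left.1 hd he h
  have h2 := hc.mono subset_union_left e he
  simpa [h1] using h2

lemma Forest.exists_no_rung (hA : Forest A) {n : ℕ} (hn : ∀ k, n ≤ k → Rails A k) :
    ∃ N, n ≤ N ∧ ∀ j, N ≤ j → r j ∉ A := by
  by_cases h : ∃ i, n ≤ i ∧ r i ∈ A
  · obtain ⟨i, h1, h2⟩ := h
    exact ⟨i + 1, by omega, fun j hj h3 => hA i j (by omega) h2 h3 fun k h4 _ => hn k (by omega)⟩
  · push Not at h
    exact ⟨n, le_rfl, h⟩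

lemma Forest.raylessForest_sdiff_rail (hA : Forest A) {k : ℕ} {x : LadderEdge} (hx : IsRail x k)
    (hrung : ∀ j, k ≤ j → r j ∉ A) : RaylessForest (A \ {x}) := by
  refine ⟨hA.mono sdiff_subset, fun i hi hk => ?_⟩
  by_cases h : i ≤ k
  · exact (rails_iff.1 (hk k h) x hx).2 rfl
  · exact hrung i (by omega) hi.1

/-- Both forests contain all late rails and hence no late rungs, so deleting one late rail `x` from
`A` and another `y` from `B` breaks every double ray. The copies to drop can be chosen outside `I`;
the remaining copy of `x` is covered by `B`, that of `y` by `A`. -/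
lemma BiForest.exists_finite_biRaylessForest_sdiff (h : BiForest J) {n : ℕ} (hJ : RailTail n J)
    (hI : ∀ m, ¬ RailTail m I) :
    ∃ Q : Set (LadderEdge × Bool), Q.Finite ∧ Disjoint I Q ∧ BiRaylessForest (J \ Q) := by
  obtain ⟨A, B, hA, hB, hc⟩ := h
  obtain ⟨N₁, -, hN₁⟩ := hA.exists_no_rung fun k hk => hJ.rails hc hk
  obtain ⟨N₂, -, hN₂⟩ := hB.exists_no_rung fun k hk => hJ.rails hc.symm hk
  unfold RailTail at hI
  push Not at hI
  obtain ⟨k, hk, x, hx, b, hxI⟩ := hI (max n (max N₁ N₂))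
  obtain ⟨l, hl, y, hy, c, hyI⟩ := hI (k + 1)
  have hxy : x ≠ y := by
    rintro rfl
    rcases hx with rfl | rfl <;> rcases hy with h | h <;> simp at h <;> omega
  refine ⟨{(x, b), (y, c)}, by simp, by simp [hxI, hyI], A \ {x}, B \ {y},
    hA.raylessForest_sdiff_rail hx fun j hj => hN₁ j (by omega),
    hB.raylessForest_sdiff_rail hy fun j hj => hN₂ j (by omega), ?_⟩
  have hxB : x ∈ B := rails_iff.1 (hJ.rails hc.symm (k := k) (by omega)) x hx
  have hyA : y ∈ A := rails_iff.1 (hJ.rails hc (k := l) (by omega)) y hy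
  rintro ⟨z, a⟩ ⟨hz, hzQ⟩
  have h1 := hc _ hz
  simp only [mem_insert_iff, mem_singleton_iff, Prod.mk.injEq, not_or] at hzQ
  by_cases hzx : z = x
  · subst hzx
    refine ⟨Or.inr ⟨hxB, by simpa using hxy⟩, fun h2 => (h2.2 ?_).elim⟩
    have : a ≠ b := fun h => hzQ.1 ⟨rfl, h⟩
    left
    cases a <;> cases b <;> simp_all
  · by_cases hzy : z = y
    · subst hzy
      refine ⟨Or.inl ⟨hyA, by simpa using hzx⟩, fun h2 => (h2.2 ?_).elim⟩
      have : a ≠ c := fun h => hzQ.2 ⟨rfl, h⟩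
      right
      cases a <;> cases c <;> simp_all
    · refine ⟨h1.1.imp (fun h => ⟨h, hzx⟩) (fun h => ⟨h, hzy⟩), fun h2 => ?_⟩
      exact ⟨⟨(h1.2 h2.1).1, hzx⟩, ⟨(h1.2 h2.1).2, hzy⟩⟩

/-! ### Rungs spanned by rails. -/

lemma Forest.exists_cycle_of_insert_rail (hA : Forest A) {x : LadderEdge} {k : ℕ}
    (hx : IsRail x k) (h : ¬ Forest (insert x A)) :
    ∃ i j, i ≤ k ∧ k < j ∧ r i ∈ A ∧ r j ∈ A ∧ ∀ l, i ≤ l → l < j → l ≠ k → Rails A l := by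
  unfold Forest at h
  push Not at h
  obtain ⟨i, j, hij, hi, hj, hl⟩ := h
  have hne : ∀ i, r i ∈ insert x A → r i ∈ A := by
    intro i hi
    rcases hx with rfl | rfl <;> simpa using hi
  have hrail : ∀ l, l ≠ k → Rails (insert x A) l → Rails A l := by
    intro l hlk h
    rcases hx with rfl | rfl <;> simpa [Rails, hlk] using h
  have hik : i ≤ k ∧ k < j := by
    by_contra h
    exact hA i j hij (hne i hi) (hne j hj) fun l h1 h2 => hrail l (by omega) (hl l h1 h2)
  exact ⟨i, j, hik.1, hik.2, hne i hi, hne j hj, fun l h1 h2 h3 => hrail l h3 (hl l h1 h2)⟩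

lemma Covers.insert_of_mem_left (hc : Covers I A B) {x : LadderEdge} {b : Bool} {B' : Set LadderEdge}
    (hxA : x ∈ A) (hB : B ⊆ B') (hx : x ∈ B') : Covers (insert (x, b) I) A B' := by
  rintro ⟨z, a⟩ hz
  by_cases hzx : z = x
  · subst hzx
    exact ⟨Or.inl hxA, fun _ => ⟨hxA, hx⟩⟩
  · have hmem : ∀ c, (z, c) ∈ insert (x, b) I → (z, c) ∈ I := by
      intro c hc
      simpa [hzx] using hc
    have h := hc _ (hmem a hz)
    exact ⟨h.1.imp id fun h => hB h, fun h' => (h.2 (hmem _ h')).imp id fun h => hB h⟩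

/-- A rail from `m` on missing from `A` would close a cycle with `A`, and a part of it would form a
cycle with `r m`. Hence `A` contains all rails from `m` on and no later rung. Some copy of such a
rail `x` is absent from `I`, and adding `x` to `B` must close a cycle with right-hand rung `r j`.
Moving `r j` to `A` makes room for `x` in `B`, contradicting that `x` is spanned. -/
lemma false_of_forest_insert_rung {n m : ℕ} (hnm : n ≤ m) (hA : Forest (insert (r m) A))
    (hrm : r m ∉ A) (hB : Forest B) (hc : Covers I A B) (hI : ∀ n, ¬ RailTail n I)
    (hcl : ∀ k, n ≤ k → ∀ x, IsRail x k → ∀ b, (x, b) ∈ I ∨ ¬ BiForest (insert (x, b) I)) :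
    False := by
  have hA₀ : Forest A := hA.mono (subset_insert _ _)
  have hstep : ∀ k, n ≤ k → ∀ x, IsRail x k → x ∈ A ∨ ¬ Forest (insert x A) := by
    intro k hk x hx
    by_contra! h
    obtain ⟨b, hb⟩ : ∃ b, (x, b) ∉ I := by
      by_contra! h'
      exact h.1 ((hc _ (h' true)).2 (h' false)).1
    refine (hcl k hk x hx b).resolve_left hb ⟨_, _, h.2, hB, ?_⟩
    rintro ⟨z, a⟩ hz
    by_cases hzx : z = x
    · subst hzx
      refine ⟨Or.inl (mem_insert _ _), fun h' => ⟨mem_insert _ _, ?_⟩⟩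
      have : (z, a) ∈ I ∨ (z, !a) ∈ I := by
        by_contra! h''
        have h3 := hz.resolve_right h''.1
        have h4 := h'.resolve_right h''.2
        simp only [Prod.mk.injEq, true_and] at h3 h4
        cases a <;> simp_all
      rcases this with h' | h'
      · exact (hc _ h').1.resolve_left h.1
      · exact (hc _ h').1.resolve_left h.1
    · have hmem : ∀ c, (z, c) ∈ insert (x, b) I → (z, c) ∈ I := by
        intro c hc
        simpa [hzx] using hc
      have h := hc _ (hmem a hz)
      exact ⟨h.1.imp (mem_insert_of_mem _) id,
        fun h' => (h.2 (hmem _ h')).imp (mem_insert_of_mem _) id⟩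
  have hcyc : ∀ i j, i < j → r i ∈ insert (r m) A → r j ∈ insert (r m) A →
      ¬ ∀ l, i ≤ l → l < j → Rails A l := by
    intro i j hij hi hj h
    refine hA i j hij hi hj fun l h1 h2 => ?_
    exact ⟨mem_insert_of_mem _ (h l h1 h2).1, mem_insert_of_mem _ (h l h1 h2).2⟩
  have hrails : ∀ k, m ≤ k → Rails A k := by
    intro k
    induction k using Nat.strong_induction_on with
    | _ k ih =>
    intro hmk
    rw [rails_iff]
    intro x hx
    by_contra hxA
    obtain ⟨i, j, hik, hkj, hi, hj, hl⟩ :=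
      hA₀.exists_cycle_of_insert_rail hx ((hstep k (by omega) x hx).resolve_left hxA)
    rcases lt_trichotomy i m with h | rfl | h
    · exact hcyc i m h (mem_insert_of_mem _ hi) (mem_insert _ _)
        fun l h1 h2 => hl l h1 (by omega) (by omega)
    · exact hrm hi
    · exact hcyc m i h (mem_insert _ _) (mem_insert_of_mem _ hi)
        fun l h1 h2 => ih l (by omega) h1
  have hrung : ∀ j, m < j → r j ∉ A := fun j hj h =>
    hcyc m j hj (mem_insert _ _) (mem_insert_of_mem _ h) fun l h1 _ => hrails l h1
  have hIm := hI m
  unfold RailTail at hIm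
  push Not at hIm
  obtain ⟨k, hk, x, hx, b, hb⟩ := hIm
  have hcl' := (hcl k (by omega) x hx b).resolve_left hb
  have hxA : x ∈ A := rails_iff.1 (hrails k hk) x hx
  have hxB : ¬ Forest (insert x B) := fun h =>
    hcl' ⟨_, _, hA₀, h, hc.insert_of_mem_left hxA (subset_insert _ _) (mem_insert _ _)⟩
  obtain ⟨i, j, hik, hkj, hi, hj, hl⟩ := hB.exists_cycle_of_insert_rail hx hxB
  have hxj : x ≠ r j := by
    rcases hx with rfl | rfl <;> simp
  refine hcl' ⟨insert (r j) A, insert x B \ {r j}, ?_, ?_, ?_⟩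
  · intro i' j' hij' hi' hj' hl'
    have hl'' : ∀ l, i' ≤ l → l < j' → Rails A l := by
      intro l h1 h2
      simpa [Rails] using hl' l h1 h2
    rcases hi' with hi' | hi' <;> rcases hj' with hj' | hj'
    · simp_all
    · obtain rfl : i' = j := by simpa using hi'
      exact hrung j' (by omega) hj'
    · obtain rfl : j' = j := by simpa using hj'
      rcases lt_trichotomy i' m with h | rfl | h
      · exact hcyc i' m h (mem_insert_of_mem _ hi') (mem_insert _ _)
          fun l h1 h2 => hl'' l h1 (by omega)
      · exact hrm hi'
      · exact hrung i' h hi'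
    · exact hA₀ i' j' hij' hi' hj' hl''
  · by_contra hF
    have hB₁ : Forest (B \ {r j}) := hB.mono sdiff_subset
    have hF' : ¬ Forest (insert x (B \ {r j})) := fun h => hF (h.mono (by grind))
    obtain ⟨i', j', hik', hkj', hi', hj', hl'⟩ := hB₁.exists_cycle_of_insert_rail hx hF'
    have hne : j' ≠ j := by
      rintro rfl
      exact hj'.2 rfl
    rcases lt_or_gt_of_ne hne with h | h
    · exact hB j' j h hj'.1 hj fun l h1 h2 => hl l (by omega) h2 (by omega)
    · exact hB j j' h hj hj'.1 fun l h1 h2 =>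
        ⟨(hl' l (by omega) h2 (by omega)).1.1, (hl' l (by omega) h2 (by omega)).2.1⟩
  · have hcx := hc.insert_of_mem_left (b := b) hxA (subset_insert x B) (mem_insert _ _)
    have hjA := hrung j (by omega)
    intro e he
    have h := hcx e he
    grind

/-- If the rails from column `n` on are spanned by a union of two forests that misses infinitely many
of them, then so are the rungs from column `n` on. -/
lemma not_biForest_insert_rung {n m : ℕ} (hnm : n ≤ m) (hI : ∀ n, ¬ RailTail n I)
    (hcl : ∀ k, n ≤ k → ∀ x, IsRail x k → ∀ b, (x, b) ∈ I ∨ ¬ BiForest (insert (x, b) I))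
    (b : Bool) : (r m, b) ∈ I ∨ ¬ BiForest (insert (r m, b) I) := by
  by_contra! h
  obtain ⟨hb, A, B, hA, hB, hc⟩ := h
  have key : ∀ A B, Forest A → Forest B → Covers (insert (r m, b) I) A B → r m ∉ A := by
    intro A B hA hB hc hmem
    refine false_of_forest_insert_rung (A := A \ {r m}) hnm (hA.mono ?_) (by simp) hB ?_ hI hcl
    · grind
    · rintro ⟨z, a⟩ hz
      have h1 := hc _ (mem_insert_of_mem _ hz)
      by_cases hzr : z = r m
      · subst hzr
        have hab : a = !b := by
          by_contra hab
          have : a = b := by cases a <;> cases b <;> simp_all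
          exact hb (this ▸ hz)
        subst hab
        refine ⟨Or.inr (h1.2 (by simp)).2, fun h' => (hb (by simpa using h')).elim⟩
      · refine ⟨h1.1.imp (fun h => ⟨h, hzr⟩) id, fun h' => ?_⟩
        exact (h1.2 (mem_insert_of_mem _ h')).imp (fun h => ⟨h, hzr⟩) id
  rcases (hc _ (mem_insert _ _)).1 with h | h
  · exact key A B hA hB hc h
  · exact key B A hB hA hc.symm h

/-! ### The matroid axioms for the union. -/

lemma not_railTail_insert (hI : ∀ n, ¬ RailTail n I) (e : LadderEdge × Bool) (n : ℕ) :
    ¬ RailTail n (insert e I) := by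
  intro h
  obtain ⟨N, hN⟩ : ∃ N, ∀ k, N ≤ k → ∀ x, IsRail x k → x ≠ e.1 := by
    obtain ⟨y, b⟩ := e
    cases y with
    | u k => exact ⟨k + 1, fun l hl x hx => by rcases hx with rfl | rfl <;> simp; omega⟩
    | d k => exact ⟨k + 1, fun l hl x hx => by rcases hx with rfl | rfl <;> simp; omega⟩
    | r k => exact ⟨0, fun l hl x hx => by rcases hx with rfl | rfl <;> simp⟩
  refine hI (max n N) fun k hk x hx b => (h k (by omega) x hx b).resolve_left fun h' => ?_
  exact hN k (by omega) x hx (congrArg Prod.fst h')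

lemma isBase_of_maximal (hB : Maximal BiRaylessForest J) (hT : ∀ n, ¬ RailTail n J) :
    biForestMatroid.IsBase J := by
  have hi : biForestMatroid.Indep J := hB.prop.biForest
  refine hi.isBase_of_forall_insert fun e he h => he.2 ?_
  have h' : BiForest (insert e J) := h
  exact hB.le_of_ge (h'.biRaylessForest (not_railTail_insert hT e)) (subset_insert _ _)
    (mem_insert _ _)

lemma isBase_union_rungPair_of_maximal {n : ℕ} (hB : Maximal BiRaylessForest J)
    (hT : RailTail n J) : biForestMatroid.IsBase (J ∪ rungPair n) := by
  have hi : biForestMatroid.Indep (J ∪ rungPair n) := hB.prop.biForest_union_rungPair hT le_rfl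
  refine hi.isBase_of_forall_insert fun e he h => he.2 ?_
  have h' : BiForest (insert e (J ∪ rungPair n)) := h
  rw [← insert_union] at h'
  have hd : Disjoint (insert e J) (rungPair n) := by
    rw [Set.disjoint_insert_left]
    exact ⟨fun h'' => he.2 (Or.inr h''), hB.prop.disjoint_rungPair hT le_rfl⟩
  exact Or.inl (hB.le_of_ge (h'.biRaylessForest_of_union_rungPair
    (hT.mono (subset_insert _ _)) le_rfl hd) (subset_insert _ _) (mem_insert _ _))

lemma exists_isBase_of_maximal (hB : Maximal BiRaylessForest J) :
    ∃ B, biForestMatroid.IsBase B ∧ J ⊆ B ∧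
      (B = J ∨ ∃ n, RailTail n J ∧ B = J ∪ rungPair n) := by
  by_cases hT : ∃ n, RailTail n J
  · obtain ⟨n, hn⟩ := hT
    exact ⟨_, isBase_union_rungPair_of_maximal hB hn, subset_union_left, Or.inr ⟨n, hn, rfl⟩⟩
  · push Not at hT
    exact ⟨_, isBase_of_maximal hB hT, subset_rfl, Or.inl rfl⟩

/-- If `I` has a full tail of rails, a late rung pair is added to `I`, and a base is found inside
`J` plus the same pair, so exchange must pick an element of `J`. If not, a base belonging to `J` may
only offer a rung of an added pair; but then the rails from that column on lie in `J`, so if `J`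
offers nothing they are spanned by `I`, and so is the rung. -/
lemma biRaylessForest_augment (hI : BiRaylessForest I) (hImax : ¬ Maximal BiRaylessForest I)
    (hJ : Maximal BiRaylessForest J) : ∃ e ∈ J \ I, BiRaylessForest (insert e I) := by
  obtain ⟨K, hK, hIK⟩ := (not_maximal_iff hI).1 hImax
  obtain ⟨y, hyK, hyI⟩ := exists_of_ssubset hIK
  have hy : BiRaylessForest (insert y I) := hK.mono (insert_subset hyK hIK.1)
  by_cases hT : ∃ n, RailTail n I
  · obtain ⟨n, hn⟩ := hT
    obtain ⟨m, hnm, B, hB, hJB⟩ : ∃ m, n ≤ m ∧ ∃ B, biForestMatroid.IsBase B ∧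
        B ⊆ J ∪ rungPair m := by
      by_cases hTJ : ∃ n', RailTail n' J
      · obtain ⟨n', hn'⟩ := hTJ
        have hn'' : RailTail (max n n') J := fun k hk => hn' k (by omega)
        exact ⟨max n n', by omega, _, isBase_union_rungPair_of_maximal hJ hn'', subset_rfl⟩
      · push Not at hTJ
        exact ⟨n, le_rfl, J, isBase_of_maximal hJ hTJ, subset_union_left⟩
    have hi : biForestMatroid.Indep (I ∪ rungPair m) := hI.biForest_union_rungPair hn hnm
    have hnb : ¬ biForestMatroid.IsBase (I ∪ rungPair m) := by
      intro h
      have hny := hn.mono (subset_insert y I)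
      have h1 : biForestMatroid.Indep (insert y (I ∪ rungPair m)) := by
        rw [← insert_union]
        exact hy.biForest_union_rungPair hny hnm
      rcases h.mem_of_insert_indep h1 with h2 | h2
      · exact hyI h2
      · exact Set.disjoint_left.1 (hy.disjoint_rungPair hny hnm) (mem_insert _ _) h2
    obtain ⟨e, ⟨heB, heI⟩, he⟩ := hi.exists_insert_of_not_isBase hnb hB
    have he' : BiForest (insert e I ∪ rungPair m) := by
      rw [insert_union]
      exact he
    refine ⟨e, ⟨(hJB heB).resolve_right fun h => heI (Or.inr h), fun h => heI (Or.inl h)⟩,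
      he'.biRaylessForest_of_union_rungPair (hn.mono (subset_insert _ _)) hnm ?_⟩
    rw [Set.disjoint_insert_left]
    exact ⟨fun h => heI (Or.inr h), hI.disjoint_rungPair hn hnm⟩
  · push Not at hT
    by_contra! hcon
    have hspan : ∀ e ∈ J, e ∈ I ∨ ¬ BiForest (insert e I) := by
      intro e he
      by_contra! h
      exact hcon e ⟨he, h.1⟩ (h.2.biRaylessForest (not_railTail_insert hT e))
    have hi : biForestMatroid.Indep I := hI.biForest
    have hnb : ¬ biForestMatroid.IsBase I := fun h =>
      hyI (h.mem_of_insert_indep (show biForestMatroid.Indep (insert y I) from hy.biForest))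
    obtain ⟨B, hB, -, hBJ⟩ := exists_isBase_of_maximal hJ
    obtain ⟨e, ⟨heB, heI⟩, he⟩ := hi.exists_insert_of_not_isBase hnb hB
    have he' : BiForest (insert e I) := he
    rcases hBJ with rfl | ⟨n, hn, rfl⟩
    · exact (hspan e heB).elim heI fun h => h he'
    · rcases heB with heB | heB
      · exact (hspan e heB).elim heI fun h => h he'
      · obtain ⟨x, b⟩ := e
        obtain rfl : x = r n := heB
        exact (not_biForest_insert_rung le_rfl hT
          (fun k hk x hx b => hspan _ (hn k hk x hx b)) b).elim heI fun h => h he'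

lemma existsMaximalSubsetProperty_biRaylessForest (X : Set (LadderEdge × Bool)) :
    Matroid.ExistsMaximalSubsetProperty BiRaylessForest X := by
  intro I hI hIX
  by_cases hT : ∃ n, RailTail n I
  · obtain ⟨n, hn⟩ := hT
    have hi : biForestMatroid.Indep (I ∪ rungPair n) := hI.biForest_union_rungPair hn le_rfl
    obtain ⟨J, hJ, hIJ⟩ := hi.subset_isBasis_of_subset (X := X ∪ rungPair n)
      (union_subset_union_left _ hIX) (subset_univ _)
    have hrJ : rungPair n ⊆ J := subset_union_right.trans hIJ
    have hJr : J \ rungPair n ∪ rungPair n = J := sdiff_union_of_subset hrJ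
    have hIJ' : I ⊆ J \ rungPair n := subset_sdiff.2
      ⟨subset_union_left.trans hIJ, hI.disjoint_rungPair hn le_rfl⟩
    have hind : BiRaylessForest (J \ rungPair n) := by
      refine BiForest.biRaylessForest_of_union_rungPair (n := n) (m := n) ?_ (hn.mono hIJ') le_rfl
        disjoint_sdiff_left
      rw [hJr]
      exact hJ.indep
    refine ⟨J \ rungPair n, hIJ', ⟨hind, ?_⟩, ?_⟩
    · rw [sdiff_subset_iff, union_comm]
      exact hJ.subset
    · rintro K ⟨hK, hKX⟩ hJK
      have hnK := hn.mono (hIJ'.trans hJK)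
      have hKi : biForestMatroid.Indep (K ∪ rungPair n) := hK.biForest_union_rungPair hnK le_rfl
      have hJK' : J ⊆ K ∪ rungPair n := sdiff_subset_iff.1 hJK |>.trans (union_comm _ _).subset
      have := hJ.eq_of_subset_indep hKi hJK' (union_subset_union_left _ hKX)
      rw [this]
      exact subset_sdiff.2 ⟨subset_union_left, hK.disjoint_rungPair hnK le_rfl⟩
  · push Not at hT
    have hi : biForestMatroid.Indep I := hI.biForest
    obtain ⟨J, hJ, hIJ⟩ := hi.subset_isBasis_of_subset hIX (subset_univ _)
    have hJi : BiForest J := hJ.indep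
    by_cases hTJ : ∃ n, RailTail n J
    · obtain ⟨n, hn⟩ := hTJ
      obtain ⟨Q, hQ, hIQ, hJQ⟩ := hJi.exists_finite_biRaylessForest_sdiff hn hT
      let P : Set (LadderEdge × Bool) → Prop := fun Y =>
        Disjoint Y (J \ Q) ∧ Y ⊆ X ∧ BiRaylessForest (J \ Q ∪ Y)
      -- Extensions of `J \ Q` inside `X` are bounded, so a maximal one exists: for a basis `K` of
      -- `X` containing `J \ Q ∪ Y`, the differences `K \ J` and `J \ K` are equinumerous and the
      -- latter lies in `Q`, while `Y` lies in `K \ J ∪ Q`.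
      have hP : ∃ n : ℕ, ∀ Y, P Y → Y.encard ≤ n := by
        refine ⟨Q.ncard + Q.ncard, fun Y ⟨hd, hYX, hY⟩ => ?_⟩
        have hYi : biForestMatroid.Indep (J \ Q ∪ Y) := hY.biForest
        obtain ⟨K, hK, hYK⟩ := hYi.subset_isBasis_of_subset
          (union_subset (sdiff_subset.trans hJ.subset) hYX) (subset_univ _)
        have h1 : (K \ J).encard ≤ Q.encard := by
          rw [hK.isBase_restrict.encard_sdiff_comm hJ.isBase_restrict]
          refine encard_le_encard fun e he => ?_
          by_contra heQ
          exact he.2 (hYK (Or.inl ⟨he.1, heQ⟩))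
        have h2 : Y ⊆ K \ J ∪ Q := by
          intro e he
          have := hYK (Or.inr he)
          have := Set.disjoint_left.1 hd he
          grind
        calc Y.encard ≤ (K \ J).encard + Q.encard := (encard_le_encard h2).trans
              (encard_union_le _ _)
          _ ≤ Q.encard + Q.encard := by gcongr
          _ = _ := by rw [← hQ.cast_ncard_eq]; simp
      obtain ⟨Y, -, ⟨⟨hd, hYX, hY⟩, -⟩, hmax⟩ := Matroid.existsMaximalSubsetProperty_of_bdd hP X ∅
        ⟨by simp, by simp, by simpa using hJQ⟩ (empty_subset _)
      refine ⟨J \ Q ∪ Y, (subset_sdiff.2 ⟨hIJ, hIQ⟩).trans subset_union_left,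
        ⟨hY, union_subset (sdiff_subset.trans hJ.subset) hYX⟩, fun K ⟨hK, hKX⟩ hYK => ?_⟩
      have hJK : J \ Q ⊆ K := subset_union_left.trans hYK
      have := hmax (y := K \ (J \ Q)) ⟨⟨disjoint_sdiff_left, sdiff_subset.trans hKX, by
        rwa [union_sdiff_cancel hJK]⟩, sdiff_subset.trans hKX⟩
        (subset_sdiff.2 ⟨subset_union_right.trans hYK, hd⟩)
      exact sdiff_subset_iff.1 this
    · push Not at hTJ
      refine ⟨J, hIJ, ⟨hJi.biRaylessForest hTJ, hJ.subset⟩, fun K ⟨hK, hKX⟩ hJK => ?_⟩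
      have hKi : biForestMatroid.Indep K := hK.biForest
      exact (hJ.eq_of_subset_indep hKi hJK hKX).symm.subset

/-- The union of the algebraic cycle matroid of the doubled ladder with itself. -/
def unionMatroid : Matroid (LadderEdge × Bool) :=
  IndepMatroid.matroid
    { E := univ
      Indep := BiRaylessForest
      indep_empty := biRaylessForest_empty
      indep_subset := fun _ _ h hs => h.mono hs
      indep_aug := fun _ _ hI hImax hJ => biRaylessForest_augment hI hImax hJ
      indep_maximal := fun X _ => existsMaximalSubsetProperty_biRaylessForest X
      subset_ground := fun _ _ => subset_univ _ }

@[simp] lemma unionMatroid_ground : unionMatroid.E = univ := rfl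

lemma isUnionOf_unionMatroid : unionMatroid.IsUnionOf doubledLadderMatroid doubledLadderMatroid where
  ground_eq := by simp
  indep_iff _ := biRaylessForest_iff

/-! ### The circuit. -/

lemma isCircuit_ladderCircuit : unionMatroid.IsCircuit ladderCircuit := by
  rw [Matroid.isCircuit_iff_dep_forall_sdiff_singleton_indep, ← Matroid.not_indep_iff]
  have hno : ∀ A : Set LadderEdge, (∀ i, r i ∉ A) → RaylessForest A := fun A h =>
    ⟨fun i _ _ hi => (h i hi).elim, fun i hi => (h i hi).elim⟩
  constructor
  · rintro ⟨A, B, hA, hB, hc⟩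
    have hu : ∀ k b, (u k, b) ∈ ladderCircuit := fun k b => Or.inl ⟨k, rfl⟩
    have hd : ∀ k b, (d k, b) ∈ ladderCircuit := fun k b => Or.inr (Or.inl ⟨k, rfl⟩)
    have h1 := fun k => (hc _ (hu k true)).2 (hu k _)
    have h2 := fun k => (hc _ (hd k true)).2 (hd k _)
    rcases (hc (r 0, false) (Or.inr (Or.inr rfl))).1 with h | h
    · exact hA.2 0 h fun k _ => ⟨(h1 k).1, (h2 k).1⟩
    · exact hB.2 0 h fun k _ => ⟨(h1 k).2, (h2 k).2⟩
  · rintro ⟨x, b⟩ hx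
    by_cases hxr : x = r 0
    · subst hxr
      refine ⟨{x | ∃ k, IsRail x k}, {x | ∃ k, IsRail x k}, hno _ (by simp [IsRail]),
        hno _ (by simp [IsRail]), ?_⟩
      rintro ⟨y, c⟩ ⟨hy, hne⟩
      have : ∃ k, IsRail y k := by
        rcases hy with ⟨n, h⟩ | ⟨n, h⟩ | h
        · exact ⟨n, Or.inl h⟩
        · exact ⟨n, Or.inr h⟩
        · refine (hne ?_).elim
          have hb : b = false := by
            rcases hx with ⟨n, h⟩ | ⟨n, h⟩ | h <;> simp_all
          rw [h, hb]
          rfl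
      exact ⟨Or.inl this, fun _ => ⟨this, this⟩⟩
    · obtain ⟨k, hk⟩ : ∃ k, IsRail x k := by
        rcases hx with ⟨n, h⟩ | ⟨n, h⟩ | h
        · exact ⟨n, Or.inl h⟩
        · exact ⟨n, Or.inr h⟩
        · exact (hxr (congrArg Prod.fst h)).elim
      -- With one copy of the rail `x` gone, only one forest needs `x`; the other takes `r 0`, and
      -- the missing rail stops its double ray.
      refine ⟨{y | y ≠ x ∧ ((∃ k, IsRail y k) ∨ y = r 0)}, {x | ∃ k, IsRail x k}, ⟨?_, ?_⟩,
        hno _ (by simp [IsRail]), ?_⟩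
      · intro i j hij hi hj
        simp [IsRail] at hi hj
        omega
      · intro i hi h
        have hi0 : i = 0 := by
          simp [IsRail] at hi
          exact hi.2
        exact (rails_iff.1 (h k (by omega)) x hk).1 rfl
      · rintro ⟨y, c⟩ ⟨hy, hne⟩
        by_cases hyx : y = x
        · subst hyx
          refine ⟨Or.inr ⟨k, hk⟩, fun h => (h.2 ?_).elim⟩
          have : c ≠ b := fun h => hne (by rw [h]; rfl)
          cases b <;> cases c <;> simp_all
        · rcases hy with ⟨n, h⟩ | ⟨n, h⟩ | h
          · have : ∃ k, IsRail y k := ⟨n, Or.inl h⟩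
            exact ⟨Or.inr this, fun _ => ⟨⟨hyx, Or.inl this⟩, this⟩⟩
          · have : ∃ k, IsRail y k := ⟨n, Or.inr h⟩
            exact ⟨Or.inr this, fun _ => ⟨⟨hyx, Or.inl this⟩, this⟩⟩
          · have hy0 : y = r 0 := congrArg Prod.fst h
            refine ⟨Or.inl ⟨hyx, Or.inr hy0⟩, fun h' => ?_⟩
            have hc0 : c = false := congrArg Prod.snd h
            subst hy0 hc0
            simp [ladderCircuit] at h'

/-! ### The cocircuit, by counting edges. -/

open Classical in
/-- The edges of the ladder between the columns `0` and `m`. -/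
noncomputable def columns : ℕ → Finset LadderEdge
  | 0 => {r 0}
  | m + 1 => insert (u m) (insert (d m) (insert (r (m + 1)) (columns m)))

lemma u_mem_columns {k m : ℕ} : u k ∈ columns m ↔ k < m := by
  induction m with
  | zero => simp [columns]
  | succ m ih => simp [columns, ih]; omega

lemma d_mem_columns {k m : ℕ} : d k ∈ columns m ↔ k < m := by
  induction m with
  | zero => simp [columns]
  | succ m ih => simp [columns, ih]; omega

lemma r_mem_columns {k m : ℕ} : r k ∈ columns m ↔ k ≤ m := by
  induction m with
  | zero => simp [columns]
  | succ m ih => simp [columns, ih]; omega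

lemma sum_columns_succ (f : LadderEdge → ℕ) (m : ℕ) : ∑ x ∈ columns (m + 1), f x =
    f (u m) + f (d m) + f (r (m + 1)) + ∑ x ∈ columns m, f x := by
  classical
  rw [columns, Finset.sum_insert, Finset.sum_insert, Finset.sum_insert]
  · ring
  · simp [r_mem_columns]
  · simp [d_mem_columns]
  · simp [u_mem_columns]

open Classical in
/-- A forest has at most `2 * m + 1` edges between the columns `0` and `m`. -/
lemma Forest.sum_columns_le (hA : Forest A) (m : ℕ) :
    ∑ x ∈ columns m, (if x ∈ A then 1 else 0) ≤ 2 * m + 1 := by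
  -- `P m` says that the two vertices of column `m` are joined in `A` within columns 0 to `m`. When
  -- they are not, the bound has one edge to spare, and carrying this spare edge makes the induction
  -- work.
  obtain ⟨P, hP⟩ : ∃ P : ℕ → Prop, ∀ m, P m ↔
      ∃ i ≤ m, r i ∈ A ∧ ∀ k, i ≤ k → k < m → Rails A k := ⟨_, fun _ => Iff.rfl⟩
  have key : ∀ m, ∑ x ∈ columns m, (if x ∈ A then 1 else 0) + (if P m then 0 else 1)
      ≤ 2 * m + 1 := by
    intro m
    induction m with
    | zero =>
      by_cases h : r 0 ∈ A
      · have hP : P 0 := (hP 0).2 ⟨0, le_rfl, h, by simp⟩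
        simp only [columns, Finset.sum_singleton, h, hP, if_true]
        omega
      · simp only [columns, Finset.sum_singleton, h, if_false]
        split_ifs <;> simp
    | succ m ih =>
      rw [sum_columns_succ]
      have h1 : r (m + 1) ∈ A → P (m + 1) := fun h =>
        (hP _).2 ⟨m + 1, le_rfl, h, fun k _ _ => by omega⟩
      have h2 : P m → Rails A m → P (m + 1) ∧ r (m + 1) ∉ A := by
        intro hPm hm
        obtain ⟨i, him, hi, hk⟩ := (hP m).1 hPm
        have hk' : ∀ k, i ≤ k → k < m + 1 → Rails A k := by
          intro k h1 h2
          rcases Nat.lt_or_eq_of_le (Nat.le_of_lt_succ h2) with h | rfl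
          · exact hk k h1 h
          · exact hm
        exact ⟨(hP _).2 ⟨i, by omega, hi, hk'⟩, fun h => hA i (m + 1) (by omega) hi h hk'⟩
      unfold Rails at h2
      split_ifs at * <;> first | omega | (exfalso; grind)
  exact (Nat.le_add_right _ _).trans (key m)

/-- The copies of the lower rails and of the rungs. -/
def ladderCocircuit : Set (LadderEdge × Bool) :=
  {e | e.2 = true ∧ ((∃ n, e.1 = d n) ∨ ∃ n, e.1 = r n)}

lemma notMem_ladderCocircuit_iff {x : LadderEdge} {b : Bool} :
    (x, b) ∉ ladderCocircuit ↔ b = false ∨ ∃ n, x = u n := by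
  cases x <;> cases b <;> simp [ladderCocircuit]

/-- Covering by two forests suffices, since no tail of rails is full; the first forest exhibited
does contain a double ray. For `d k`, the rung `r (k + 1)` goes to the first forest, as in the
second it would close a cycle with `d k`, `u k` and `r k`. -/
lemma biRaylessForest_insert_compl {f : LadderEdge × Bool} (hf : f ∈ ladderCocircuit) :
    BiRaylessForest (insert f ladderCocircuitᶜ) := by
  have htail : ∀ n, ¬ RailTail n (insert f ladderCocircuitᶜ) := by
    refine fun n => not_railTail_insert (fun n hn => ?_) f n
    have := hn n le_rfl (d n) (Or.inr rfl) true
    exact this ⟨rfl, Or.inl ⟨n, rfl⟩⟩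
  refine BiForest.biRaylessForest ?_ htail
  obtain ⟨x, b⟩ := f
  obtain ⟨rfl, hx⟩ : b = true ∧ _ := hf
  rcases hx with ⟨k, hk⟩ | ⟨k, hk⟩
  · obtain rfl : x = d k := hk
    refine ⟨{x | (∃ l, IsRail x l) ∨ x = r (k + 1)},
      {x | (∃ l, x = u l ∨ x = r l ∧ l ≠ k + 1) ∨ x = d k}, ?_, ?_, ?_⟩
    · intro i j hij hi hj
      simp [IsRail] at hi hj
      omega
    · intro i j hij hi hj hl
      have h1 := (hl i le_rfl hij).2
      have h2 := (hl (j - 1) (by omega) (by omega)).2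
      simp at h1 h2 hi hj
      omega
    · rintro ⟨y, c⟩ hy
      rw [mem_insert_iff, mem_compl_iff, notMem_ladderCocircuit_iff] at hy
      simp only [mem_insert_iff, mem_compl_iff, notMem_ladderCocircuit_iff]
      cases y <;> cases c <;> simp_all [IsRail]
      tauto
  · obtain rfl : x = r k := hk
    refine ⟨{x | (∃ l, IsRail x l) ∨ x = r k}, {x | ∃ l, x = u l ∨ x = r l}, ?_, ?_, ?_⟩
    · intro i j hij hi hj
      simp [IsRail] at hi hj
      omega
    · intro i j hij hi hj hl
      simpa using (hl i le_rfl hij).2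
    · rintro ⟨y, c⟩ hy
      rw [mem_insert_iff, mem_compl_iff, notMem_ladderCocircuit_iff] at hy
      simp only [mem_insert_iff, mem_compl_iff, notMem_ladderCocircuit_iff]
      cases y <;> cases c <;> simp_all [IsRail]

/-- Take `m` so large that columns 0 to `m` contain both extra edges. The set then has at least (3m
+ 1) + m + 2 = 4m + 3 edges there, more than the 2(2m + 1) available to two forests. -/
lemma not_biForest_insert_insert_compl {f g : LadderEdge × Bool} (hf : f ∈ ladderCocircuit)
    (hg : g ∈ ladderCocircuit) (hfg : f ≠ g) :
    ¬ BiForest (insert g (insert f ladderCocircuitᶜ)) := by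
  classical
  rintro ⟨A, B, hA, hB, hc⟩
  obtain ⟨x, b⟩ := f
  obtain ⟨y, c⟩ := g
  obtain ⟨rfl, hx⟩ : b = true ∧ _ := hf
  obtain ⟨rfl, hy⟩ : c = true ∧ _ := hg
  have hxy : x ≠ y := fun h => hfg (by rw [h])
  have hcol : ∀ z : LadderEdge, ∃ N, ∀ m, N ≤ m → z ∈ columns m := by
    intro z
    cases z with
    | u k => exact ⟨k + 1, fun m hm => u_mem_columns.2 hm⟩
    | d k => exact ⟨k + 1, fun m hm => d_mem_columns.2 hm⟩
    | r k => exact ⟨k, fun m hm => r_mem_columns.2 hm⟩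
  obtain ⟨N₁, hN₁⟩ := hcol x
  obtain ⟨N₂, hN₂⟩ := hcol y
  set J := insert (y, true) (insert (x, true) ladderCocircuitᶜ) with hJ
  set m := max N₁ N₂
  have hfalse : ∀ z, (z, false) ∈ J := fun z =>
    Or.inr (Or.inr (notMem_ladderCocircuit_iff.2 (Or.inl rfl)))
  have hu : ∀ k, (u k, true) ∈ J := fun k =>
    Or.inr (Or.inr (notMem_ladderCocircuit_iff.2 (Or.inr ⟨k, rfl⟩)))
  have hcard : ∀ m, ∑ z ∈ columns m, 1 = 3 * m + 1 := by
    intro m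
    induction m with
    | zero => simp [columns]
    | succ m ih => rw [sum_columns_succ, ih]; ring
  have hnu : ∀ z, ((∃ n, z = d n) ∨ ∃ n, z = r n) → z ∉ (Finset.range m).image u := by
    rintro z (⟨n, rfl⟩ | ⟨n, rfl⟩) <;> simp
  have hlower : m + 2 ≤ ∑ z ∈ columns m, (if (z, true) ∈ J then 1 else 0) := by
    rw [← Finset.card_filter]
    calc m + 2 = (insert y (insert x ((Finset.range m).image u))).card := by
          rw [Finset.card_insert_of_notMem, Finset.card_insert_of_notMem,
            Finset.card_image_of_injective, Finset.card_range]
          · intro k l h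
            simpa using h
          · exact hnu x hx
          · rw [Finset.mem_insert, not_or]
            exact ⟨hxy.symm, hnu y hy⟩
      _ ≤ _ := by
          refine Finset.card_le_card fun z hz => ?_
          rw [Finset.mem_filter]
          rw [Finset.mem_insert, Finset.mem_insert, Finset.mem_image] at hz
          rcases hz with rfl | rfl | ⟨k, hk, rfl⟩
          · exact ⟨hN₂ _ (le_max_right _ _), Or.inl rfl⟩
          · exact ⟨hN₁ _ (le_max_left _ _), Or.inr (Or.inl rfl)⟩
          · exact ⟨u_mem_columns.2 (Finset.mem_range.1 hk), hu k⟩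
  have hupper : ∑ z ∈ columns m, (1 + if (z, true) ∈ J then 1 else 0) ≤
      ∑ z ∈ columns m, ((if z ∈ A then 1 else 0) + if z ∈ B then 1 else 0) := by
    refine Finset.sum_le_sum fun z _ => ?_
    have := hc _ (hfalse z)
    simp only [Bool.not_false] at this
    split_ifs <;> first | omega | (exfalso; tauto)
  rw [Finset.sum_add_distrib, Finset.sum_add_distrib, hcard] at hupper
  have h1 := hA.sum_columns_le m
  have h2 := hB.sum_columns_le m
  omega

lemma isBase_insert_compl {f : LadderEdge × Bool} (hf : f ∈ ladderCocircuit) :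
    unionMatroid.IsBase (insert f ladderCocircuitᶜ) := by
  have hi : unionMatroid.Indep (insert f ladderCocircuitᶜ) := biRaylessForest_insert_compl hf
  refine hi.isBase_of_forall_insert fun g hg h => ?_
  have h' : BiRaylessForest (insert g (insert f ladderCocircuitᶜ)) := h
  refine not_biForest_insert_insert_compl hf (g := g) ?_ ?_ h'.biForest
  · by_contra hgC
    exact hg.2 (Or.inr hgC)
  · rintro rfl
    exact hg.2 (mem_insert _ _)

lemma isCocircuit_ladderCocircuit : unionMatroid.IsCocircuit ladderCocircuit := by
  rw [Matroid.isCocircuit_iff_minimal_compl_nonspanning]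
  have hmem : ((d 0, true) : LadderEdge × Bool) ∈ ladderCocircuit := ⟨rfl, Or.inl ⟨0, rfl⟩⟩
  constructor
  · intro h
    rw [unionMatroid_ground, ← compl_eq_univ_sdiff] at h
    have hb := isBase_insert_compl hmem
    have hi := hb.indep.subset (subset_insert _ _)
    exact (hi.isBase_of_spanning h).mem_of_insert_indep hb.indep hmem
  · intro D hD hDC f hf
    by_contra hfD
    refine hD ((isBase_insert_compl hf).spanning.superset ?_)
    rw [unionMatroid_ground, ← compl_eq_univ_sdiff]
    exact insert_subset hfD (compl_subset_compl.2 hDC)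

lemma infinite_ladderCircuit_inter_ladderCocircuit :
    (ladderCircuit ∩ ladderCocircuit).Infinite := by
  refine Set.infinite_of_injective_forall_mem (f := fun n : ℕ => ((d n, true) : LadderEdge × Bool))
    ?_ fun n => ⟨Or.inr (Or.inl ⟨n, rfl⟩), rfl, Or.inl ⟨n, rfl⟩⟩
  intro m n h
  simpa using h

end LadderEdge

/-- The doubled ladder `H` has an algebraic cycle matroid `M`, the union `N = M ∨ M` is a matroid, it
is wild, and in fact the set of all horizontal edges together with the first rung is a circuit of `N`
that meets some cocircuit of `N` in an infinite set. -/
theorem theorem4p3 :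
    ∃ M : Matroid (LadderEdge × Bool), M.IsAlgebraicCycleMatroid doubledLadder ∧
      ∃ N : Matroid (LadderEdge × Bool), N.IsUnionOf M M ∧ N.IsWild ∧
        N.IsCircuit ladderCircuit ∧
        ∃ D : Set (LadderEdge × Bool), N.IsCocircuit D ∧ (ladderCircuit ∩ D).Infinite :=
  ⟨doubledLadderMatroid, isAlgebraicCycleMatroid_doubledLadderMatroid, LadderEdge.unionMatroid,
    LadderEdge.isUnionOf_unionMatroid,
    fun h => LadderEdge.infinite_ladderCircuit_inter_ladderCocircuit
      (h _ _ LadderEdge.isCircuit_ladderCircuit LadderEdge.isCocircuit_ladderCocircuit),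
    LadderEdge.isCircuit_ladderCircuit, LadderEdge.ladderCocircuit,
    LadderEdge.isCocircuit_ladderCocircuit,
    LadderEdge.infinite_ladderCircuit_inter_ladderCocircuit⟩
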